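/- Let $\mathbb D$ be the open unit disk of $\mathbb C$ and let $\mathcal A$ be the normalized area measure $d\mathcal A = dx\,dy/\pi$ on $\mathbb D$. An Orlicz function is an increasing convex function $\Psi\colon[0,\infty)\to[0,\infty)$ with $\Psi(0)=0$, $\Psi(x)>0$ for $x>0$ and $\Psi(x)\to\infty$ as $x\to\infty$; its inverse $\Psi^{-1}$ is extended by $\Psi^{-1}(\infty)=\infty$. For a positive measure $\nu$ on $\mathbb D$, $L^\Psi(\nu)$ is the space of ($\nu$-classes of) measurable functions $f\colon\mathbb D\to\mathbb C$ with $\int_{\mathbb D}\Psi(|f|/C)\,d\nu<\infty$ for some $C>0$, normed by $\|f\|=\inf\{C>0:\int_{\mathbb D}\Psi(|f|/C)\,d\nu\le1\}$, and the Bergman--Orlicz space $\mathfrak B^\Psi$ is the subspace of $L^\Psi(\mathcal A)$ of functions analytic in $\mathbb D$. Let $\mu$ be a finite positive Borel measure on $\mathbb D$. For $|\xi|=1$ and $h>0$ put $$W(\xi,h)=\{z\in\mathbb D:\ |z|\ge 1-h,\ |\arg(z\bar\xi)|\le\pi h\},\qquad \rho_\mu(h)=\sup_{|\xi|=1}\mu\big(W(\xi,h)\big),\qquad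 K_{\mu,2}(h)=\sup_{0<t<h}\frac{\rho_\mu(t)}{t^2}\in[0,\infty].$$ Let $\Psi_1$ and $\Psi_2$ be two Orlicz functions, and let $I_\mu\colon\mathfrak B^{\Psi_1}\to L^{\Psi_2}(\mu)$ be the canonical map $I_\mu(f)=f$; to say that $I_\mu$ is compact includes that it is well defined, i.e. that $\mathfrak B^{\Psi_1}\subseteq L^{\Psi_2}(\mu)$. In the quotients below, computed in $[0,\infty]$, we use $1/0=\infty$, $1/\infty=0$, and, for $0<x<\infty$, $x/0=\infty$ and $x/\infty=0$. 1) If $I_\mu$ is compact, then $$\lim_{h\to0^+}\frac{\Psi_1^{-1}(1/h^2)}{\Psi_2^{-1}\big(1/\rho_\mu(h)\big)}=0.$$ 2) If $$\lim_{h\to0^+}\frac{\Psi_1^{-1}(1/h^2)}{\Psi_2^{-1}\big(1/(h^2K_{\mu,2}(h))\big)}=0,$$ then $I_\mu$ is compact. -/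

import Mathlib

open MeasureTheory Filter Set Topology
open scoped NNReal ENNReal

/-- An Orlicz function: a function from `[0, ∞)` to `[0, ∞)` which is positive off `0`, increasing
and convex, vanishes at `0` and tends to infinity at infinity. -/
structure OrliczFunction where
  toFun : ℝ≥0 → ℝ≥0
  map_zero : toFun 0 = 0
  pos : ∀ x, 0 < x → 0 < toFun x
  mono : Monotone toFun
  convex : ConvexOn ℝ≥0 Set.univ toFun
  tendsto_atTop : Tendsto toFun atTop atTop

namespace OrliczFunction

instance : CoeFun OrliczFunction (fun _ => ℝ≥0 → ℝ≥0) := ⟨OrliczFunction.toFun⟩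

/-- The inverse function of `Ψ`, extended to `[0, ∞]`: for finite `y` it is the only `x` with
`Ψ x = y`, and its value at `∞` is `∞`. -/
noncomputable def inv (Ψ : OrliczFunction) (y : ℝ≥0∞) : ℝ≥0∞ :=
  sSup {x : ℝ≥0∞ | ∃ t : ℝ≥0, x = t ∧ (Ψ t : ℝ≥0∞) ≤ y}

theorem apply_mul_le (Ψ : OrliczFunction) {a : ℝ≥0} (ha : a ≤ 1) (x : ℝ≥0) :
    Ψ (a * x) ≤ a * Ψ x := by
  have h := Ψ.convex.2 (mem_univ x) (mem_univ 0) (zero_le (a := a)) (zero_le (a := 1 - a))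
    (add_tsub_cancel_of_le ha)
  simpa [Ψ.map_zero] using h

theorem apply_div_add_le (Ψ : OrliczFunction) {C D : ℝ≥0} (hC : 0 < C) (hD : 0 < D)
    (x y : ℝ≥0) :
    Ψ ((x + y) / (C + D)) ≤ C / (C + D) * Ψ (x / C) + D / (C + D) * Ψ (y / D) := by
  have hCD : C + D ≠ 0 := (add_pos hC hD).ne'
  have h := Ψ.convex.2 (mem_univ (x / C)) (mem_univ (y / D)) (zero_le (a := C / (C + D)))
    (zero_le (a := D / (C + D))) (by rw [← add_div, div_self hCD])
  have e : (C / (C + D)) • (x / C) + (D / (C + D)) • (y / D) = (x + y) / (C + D) := by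
    have := hC.ne'
    have := hD.ne'
    simp only [smul_eq_mul]
    field_simp
  rw [e] at h
  simpa using h

end OrliczFunction

section OrliczSpace

variable {α : Type*} [MeasurableSpace α]

/-- The integral of `Ψ (|f| / C)` with respect to `μ`. -/
noncomputable def orliczModular (Ψ : OrliczFunction) (μ : Measure α) (f : α → ℂ) (C : ℝ≥0) :
    ℝ≥0∞ :=
  ∫⁻ x, (Ψ (‖f x‖₊ / C) : ℝ≥0∞) ∂μ

theorem orliczModular_congr (Ψ : OrliczFunction) {μ : Measure α} {f g : α → ℂ} (h : f =ᵐ[μ] g)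
    (C : ℝ≥0) : orliczModular Ψ μ f C = orliczModular Ψ μ g C :=
  lintegral_congr_ae (h.mono fun x hx => by simp only [hx])

theorem orliczModular_zero (Ψ : OrliczFunction) (μ : Measure α) (C : ℝ≥0) :
    orliczModular Ψ μ (0 : α → ℂ) C = 0 := by
  simp [orliczModular, Ψ.map_zero]

theorem orliczModular_aemeasurable (Ψ : OrliczFunction) {μ : Measure α} {f : α → ℂ}
    (hf : AEStronglyMeasurable f μ) (C : ℝ≥0) :
    AEMeasurable (fun x => (Ψ (‖f x‖₊ / C) : ℝ≥0∞)) μ :=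
  (Ψ.mono.measurable.comp_aemeasurable
    (hf.aemeasurable.nnnorm.div_const C)).coe_nnreal_ennreal

theorem orliczModular_anti (Ψ : OrliczFunction) (μ : Measure α) (f : α → ℂ) {C D : ℝ≥0}
    (hC : 0 < C) (h : C ≤ D) : orliczModular Ψ μ f D ≤ orliczModular Ψ μ f C := by
  refine lintegral_mono fun x => ?_
  exact ENNReal.coe_le_coe.2 (Ψ.mono (by gcongr))

theorem orliczModular_mul_le (Ψ : OrliczFunction) (μ : Measure α) (f : α → ℂ) (C : ℝ≥0)
    {k : ℝ≥0} (hk : 1 ≤ k) :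
    orliczModular Ψ μ f (k * C) ≤ (k⁻¹ : ℝ≥0) * orliczModular Ψ μ f C := by
  unfold orliczModular
  rw [← lintegral_const_mul' _ _ ENNReal.coe_ne_top]
  refine lintegral_mono fun x => ?_
  have h := Ψ.apply_mul_le (inv_le_one_of_one_le₀ hk) (‖f x‖₊ / C)
  have e : k⁻¹ * (‖f x‖₊ / C) = ‖f x‖₊ / (k * C) := by
    rw [div_eq_mul_inv, div_eq_mul_inv, mul_inv]; ring
  rw [e] at h
  rw [← ENNReal.coe_mul]
  exact ENNReal.coe_le_coe.2 h

theorem orliczModular_add_le (Ψ : OrliczFunction) {μ : Measure α} {f g : α → ℂ}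
    (hf : AEStronglyMeasurable f μ) {C D : ℝ≥0} (hC : 0 < C) (hD : 0 < D) :
    orliczModular Ψ μ (f + g) (C + D) ≤
      (C / (C + D) : ℝ≥0) * orliczModular Ψ μ f C
        + (D / (C + D) : ℝ≥0) * orliczModular Ψ μ g D := by
  unfold orliczModular
  rw [← lintegral_const_mul' _ _ ENNReal.coe_ne_top, ← lintegral_const_mul' _ _ ENNReal.coe_ne_top,
    ← lintegral_add_left' ((orliczModular_aemeasurable Ψ hf C).const_mul _)]
  refine lintegral_mono fun x => ?_
  have h1 : Ψ (‖(f + g) x‖₊ / (C + D)) ≤ Ψ ((‖f x‖₊ + ‖g x‖₊) / (C + D)) :=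
    Ψ.mono (by gcongr; exact nnnorm_add_le _ _)
  rw [← ENNReal.coe_mul, ← ENNReal.coe_mul, ← ENNReal.coe_add]
  exact ENNReal.coe_le_coe.2 (h1.trans (Ψ.apply_div_add_le hC hD _ _))

theorem orliczModular_smul (Ψ : OrliczFunction) (μ : Measure α) (f : α → ℂ) (C : ℝ≥0) {c : ℂ}
    (hc : c ≠ 0) : orliczModular Ψ μ (c • f) (‖c‖₊ * C) = orliczModular Ψ μ f C := by
  unfold orliczModular
  refine lintegral_congr fun x => ?_
  have : ‖c‖₊ ≠ 0 := by simpa using hc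
  rw [Pi.smul_apply, smul_eq_mul, nnnorm_mul, mul_div_mul_left _ _ this]

/-- The Orlicz space `L^Ψ(μ)` of classes of measurable functions `f` such that
`∫ Ψ (|f| / C) dμ < ∞` for some `C > 0`. -/
def OrliczSpace (Ψ : OrliczFunction) (μ : Measure α) : Submodule ℂ (α →ₘ[μ] ℂ) where
  carrier := {f | ∃ C : ℝ≥0, 0 < C ∧ orliczModular Ψ μ f C < ∞}
  zero_mem' := ⟨1, one_pos, by
    rw [orliczModular_congr Ψ AEEqFun.coeFn_zero, orliczModular_zero]; simp⟩
  add_mem' := by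
    rintro f g ⟨C, hC, hf⟩ ⟨D, hD, hg⟩
    refine ⟨C + D, add_pos hC hD, ?_⟩
    rw [orliczModular_congr Ψ (AEEqFun.coeFn_add f g)]
    exact (orliczModular_add_le Ψ f.aestronglyMeasurable hC hD).trans_lt
      (ENNReal.add_lt_top.2 ⟨ENNReal.mul_lt_top ENNReal.coe_lt_top hf,
        ENNReal.mul_lt_top ENNReal.coe_lt_top hg⟩)
  smul_mem' := by
    rintro c f ⟨C, hC, hf⟩
    rcases eq_or_ne c 0 with rfl | hc
    · refine ⟨1, one_pos, ?_⟩
      rw [zero_smul, orliczModular_congr Ψ AEEqFun.coeFn_zero, orliczModular_zero]; simp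
    · refine ⟨‖c‖₊ * C, mul_pos (by simpa using hc) hC, ?_⟩
      rwa [orliczModular_congr Ψ (AEEqFun.coeFn_smul c f), orliczModular_smul Ψ μ f C hc]

namespace OrliczSpace

variable {Ψ : OrliczFunction} {μ : Measure α}

/-- The constants `C > 0` with `∫ Ψ (|f| / C) dμ ≤ 1`. -/
def admissible (f : OrliczSpace Ψ μ) : Set ℝ :=
  {C : ℝ | 0 < C ∧ orliczModular Ψ μ (f : α →ₘ[μ] ℂ) C.toNNReal ≤ 1}

/-- The Luxemburg norm: the infimum of the constants `C > 0` with `∫ Ψ (|f| / C) dμ ≤ 1`. -/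
noncomputable instance : Norm (OrliczSpace Ψ μ) := ⟨fun f => sInf (admissible f)⟩

theorem norm_def (f : OrliczSpace Ψ μ) : ‖f‖ = sInf (admissible f) := rfl

theorem bddBelow_admissible (f : OrliczSpace Ψ μ) : BddBelow (admissible f) :=
  ⟨0, fun _ h => h.1.le⟩

theorem admissible_nonempty (f : OrliczSpace Ψ μ) : (admissible f).Nonempty := by
  obtain ⟨f, C, hC, hf⟩ := f
  set M := (orliczModular Ψ μ f C).toNNReal with hM
  have hM' : orliczModular Ψ μ f C = M := (ENNReal.coe_toNNReal hf.ne).symm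
  have hk : 1 ≤ max M 1 := le_max_right _ _
  have hk0 : 0 < max M 1 := one_pos.trans_le hk
  refine ⟨((max M 1 * C : ℝ≥0) : ℝ), by exact_mod_cast mul_pos hk0 hC, ?_⟩
  rw [Real.toNNReal_coe]
  refine (orliczModular_mul_le Ψ μ f C hk).trans ?_
  rw [hM', ← ENNReal.coe_mul, ← ENNReal.coe_one, ENNReal.coe_le_coe, inv_mul_le_iff₀ hk0, mul_one]
  exact le_max_left _ _

theorem modular_le_one_of_norm_lt {f : OrliczSpace Ψ μ} {C : ℝ} (h : ‖f‖ < C) :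
    0 < C ∧ orliczModular Ψ μ (f : α →ₘ[μ] ℂ) C.toNNReal ≤ 1 := by
  obtain ⟨D, hD, hDC⟩ := exists_lt_of_csInf_lt (admissible_nonempty f) h
  exact ⟨hD.1.trans hDC, (orliczModular_anti Ψ μ _ (Real.toNNReal_pos.2 hD.1)
    (Real.toNNReal_le_toNNReal hDC.le)).trans hD.2⟩

theorem norm_le_of_modular {f : OrliczSpace Ψ μ} {C : ℝ} (hC : 0 < C)
    (h : orliczModular Ψ μ (f : α →ₘ[μ] ℂ) C.toNNReal ≤ 1) : ‖f‖ ≤ C :=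
  csInf_le (bddBelow_admissible f) ⟨hC, h⟩

theorem norm_nonneg' (f : OrliczSpace Ψ μ) : 0 ≤ ‖f‖ :=
  le_csInf (admissible_nonempty f) fun _ h => h.1.le

theorem norm_zero' : ‖(0 : OrliczSpace Ψ μ)‖ = 0 := by
  refine le_antisymm (le_of_forall_pos_le_add fun ε hε => ?_) (norm_nonneg' _)
  rw [zero_add]
  refine norm_le_of_modular hε ?_
  rw [orliczModular_congr Ψ (g := 0) (by exact AEEqFun.coeFn_zero), orliczModular_zero]
  exact zero_le_one

theorem norm_add_le' (f g : OrliczSpace Ψ μ) : ‖f + g‖ ≤ ‖f‖ + ‖g‖ := by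
  refine le_of_forall_pos_le_add fun ε hε => ?_
  obtain ⟨hC, hf⟩ := modular_le_one_of_norm_lt (f := f) (C := ‖f‖ + ε / 2) (by linarith)
  obtain ⟨hD, hg⟩ := modular_le_one_of_norm_lt (f := g) (C := ‖g‖ + ε / 2) (by linarith)
  have e : ‖f‖ + ‖g‖ + ε = (‖f‖ + ε / 2) + (‖g‖ + ε / 2) := by ring
  rw [e]
  generalize ‖f‖ + ε / 2 = C at hC hf
  generalize ‖g‖ + ε / 2 = D at hD hg
  refine norm_le_of_modular (add_pos hC hD) ?_
  rw [Submodule.coe_add, orliczModular_congr Ψ (AEEqFun.coeFn_add (f : α →ₘ[μ] ℂ) g),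
    Real.toNNReal_add hC.le hD.le]
  have hC' := Real.toNNReal_pos.2 hC
  have hD' := Real.toNNReal_pos.2 hD
  refine (orliczModular_add_le Ψ (f : α →ₘ[μ] ℂ).aestronglyMeasurable hC' hD').trans ?_
  refine (add_le_add (mul_le_mul_right hf _) (mul_le_mul_right hg _)).trans ?_
  rw [mul_one, mul_one, ← ENNReal.coe_add, ← add_div, div_self (add_pos hC' hD').ne',
    ENNReal.coe_one]

theorem norm_smul_le' (c : ℂ) (f : OrliczSpace Ψ μ) : ‖c • f‖ ≤ ‖c‖ * ‖f‖ := by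
  rcases eq_or_ne c 0 with rfl | hc
  · rw [zero_smul, norm_zero', norm_zero, zero_mul]
  have hc' : 0 < ‖c‖ := norm_pos_iff.2 hc
  rw [← div_le_iff₀' hc']
  refine le_csInf (admissible_nonempty f) fun C hC => ?_
  rw [div_le_iff₀' hc']
  refine norm_le_of_modular (mul_pos hc' hC.1) ?_
  rw [Submodule.coe_smul, orliczModular_congr Ψ (AEEqFun.coeFn_smul c (f : α →ₘ[μ] ℂ)),
    Real.toNNReal_mul hc'.le, norm_toNNReal, orliczModular_smul Ψ μ _ _ hc]
  exact hC.2

theorem norm_smul' (c : ℂ) (f : OrliczSpace Ψ μ) : ‖c • f‖ = ‖c‖ * ‖f‖ := by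
  refine le_antisymm (norm_smul_le' c f) ?_
  rcases eq_or_ne c 0 with rfl | hc
  · rw [norm_zero, zero_mul]; exact norm_nonneg' _
  have h := norm_smul_le' c⁻¹ (c • f)
  rwa [inv_smul_smul₀ hc, norm_inv, ← div_eq_inv_mul, le_div_iff₀' (norm_pos_iff.2 hc)] at h

theorem eq_zero_of_norm_eq_zero {f : OrliczSpace Ψ μ} (h : ‖f‖ = 0) : f = 0 := by
  have key : orliczModular Ψ μ (f : α →ₘ[μ] ℂ) 1 = 0 := by
    refine le_antisymm (ENNReal.le_of_forall_pos_le_add fun ε hε _ => ?_) zero_le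
    rw [zero_add]
    set δ := min ε 1 with hδ
    have hδ0 : 0 < δ := lt_min hε one_pos
    have h1 := (modular_le_one_of_norm_lt (f := f) (C := δ) (by rw [h]; exact_mod_cast hδ0)).2
    rw [Real.toNNReal_coe] at h1
    have h2 := orliczModular_mul_le Ψ μ (f : α →ₘ[μ] ℂ) δ
      ((one_le_inv₀ hδ0).2 (min_le_right ε 1))
    rw [inv_mul_cancel₀ hδ0.ne', inv_inv] at h2
    refine h2.trans ((mul_le_mul_right h1 _).trans ?_)
    rw [mul_one]
    exact_mod_cast min_le_left ε 1
  rw [orliczModular, lintegral_eq_zero_iff' (orliczModular_aemeasurable Ψ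
    (f : α →ₘ[μ] ℂ).aestronglyMeasurable 1)] at key
  refine Subtype.ext (AEEqFun.ext ?_)
  have h0 : ((f : α →ₘ[μ] ℂ) : α → ℂ) =ᵐ[μ] 0 := ?_
  · exact h0.trans AEEqFun.coeFn_zero.symm
  refine key.mono fun x hx => ?_
  by_contra hne
  have := Ψ.pos (‖(f : α →ₘ[μ] ℂ) x‖₊ / 1) (by simpa using hne)
  simp only [Pi.zero_apply, ENNReal.coe_eq_zero] at hx
  exact this.ne' hx

theorem normedSpaceCore : NormedSpace.Core ℂ (OrliczSpace Ψ μ) where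
  norm_nonneg := norm_nonneg'
  norm_smul := norm_smul'
  norm_triangle := norm_add_le'
  norm_eq_zero_iff _ := ⟨eq_zero_of_norm_eq_zero, by rintro rfl; exact norm_zero'⟩

noncomputable instance : NormedAddCommGroup (OrliczSpace Ψ μ) :=
  NormedAddCommGroup.ofCore normedSpaceCore

noncomputable instance : NormedSpace ℂ (OrliczSpace Ψ μ) :=
  NormedSpace.ofCore normedSpaceCore

end OrliczSpace

end OrliczSpace

/-- The open unit disk. -/
def unitDisk : Set ℂ := Metric.ball 0 1

/-- The normalized area measure `dx dy / π` on the unit disk. -/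
noncomputable def diskArea : Measure ℂ :=
  ENNReal.ofReal (1 / Real.pi) • (volume : Measure ℂ).restrict unitDisk

/-- The Bergman-Orlicz space `𝔅^Ψ`: the subspace of the elements of `L^Ψ` of the disk which are
(classes of) analytic functions on the disk, with the norm of `L^Ψ`. -/
def BergmanOrlicz (Ψ : OrliczFunction) : Submodule ℂ (OrliczSpace Ψ diskArea) where
  carrier := {f | ∃ g : ℂ → ℂ, DifferentiableOn ℂ g unitDisk ∧
    ((f : ℂ →ₘ[diskArea] ℂ) : ℂ → ℂ) =ᵐ[diskArea] g}
  zero_mem' := ⟨0, differentiableOn_const 0, AEEqFun.coeFn_zero⟩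
  add_mem' := by
    rintro f₁ f₂ ⟨g₁, h₁, e₁⟩ ⟨g₂, h₂, e₂⟩
    exact ⟨g₁ + g₂, h₁.add h₂,
      (AEEqFun.coeFn_add (f₁ : ℂ →ₘ[diskArea] ℂ) f₂).trans (e₁.add e₂)⟩
  smul_mem' := by
    rintro c f ⟨g, h, e⟩
    exact ⟨c • g, h.const_smul c,
      (AEEqFun.coeFn_smul c (f : ℂ →ₘ[diskArea] ℂ)).trans (e.const_smul c)⟩

/-- `T` is the canonical map `I_μ : 𝔅^Ψ₁ → L^Ψ₂(μ)`, `I_μ f = f`: it sends (the class of) each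
analytic function `g` to the `μ`-class of the same function `g`. -/
def IsCanonicalEmbedding {Ψ₁ Ψ₂ : OrliczFunction} {μ : Measure ℂ}
    (T : BergmanOrlicz Ψ₁ →ₗ[ℂ] OrliczSpace Ψ₂ μ) : Prop :=
  ∀ (f : BergmanOrlicz Ψ₁) (g : ℂ → ℂ), DifferentiableOn ℂ g unitDisk →
    (((f : OrliczSpace Ψ₁ diskArea) : ℂ →ₘ[diskArea] ℂ) : ℂ → ℂ) =ᵐ[diskArea] g →
    ((T f : ℂ →ₘ[μ] ℂ) : ℂ → ℂ) =ᵐ[μ] g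

/-- The canonical map `I_μ : 𝔅^Ψ₁ → L^Ψ₂(μ)` is well defined and compact. -/
def CompactCanonicalEmbedding (Ψ₁ Ψ₂ : OrliczFunction) (μ : Measure ℂ) : Prop :=
  ∃ T : BergmanOrlicz Ψ₁ →ₗ[ℂ] OrliczSpace Ψ₂ μ, IsCanonicalEmbedding T ∧ IsCompactOperator T

/-- The Carleson window `W(ξ, h)`. -/
def carlesonWindow (ξ : ℂ) (h : ℝ) : Set ℂ :=
  {z | z ∈ unitDisk ∧ 1 - h ≤ ‖z‖ ∧ |Complex.arg (z * (starRingEnd ℂ) ξ)| ≤ Real.pi * h}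

/-- The Carleson function `ρ_μ`. -/
noncomputable def carlesonFunction (μ : Measure ℂ) (h : ℝ) : ℝ≥0∞ :=
  ⨆ ξ ∈ Metric.sphere (0 : ℂ) 1, μ (carlesonWindow ξ h)

/-- The function `K_{μ,2}(h) = sup_{0 < t < h} ρ_μ(t) / t²`, with values in `[0, ∞]`. -/
noncomputable def carlesonK (μ : Measure ℂ) (h : ℝ) : ℝ≥0∞ :=
  ⨆ t ∈ Set.Ioo (0 : ℝ) h, carlesonFunction μ t / ENNReal.ofReal (t ^ 2)

/-!
Both implications compare the two norms on Carleson windows.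

*Necessity.* For `|ξ| = 1` and small `h`, the function `(h / (1 - (1 - h) ξ̄ z))⁴` is bounded by
`1`, is bounded below on `W(ξ, h)`, and has `L¹` norm `O(h²)`. By convexity of `Ψ₁`, its multiples by
the numbers `t` with `Ψ₁ t ≤ 1 / h²` stay in a fixed ball of the Bergman-Orlicz space
(`orliczModular_carlesonTest_le`), and they tend to zero pointwise as `h → 0` since `Ψ₁` grows at
least linearly. A compact `I_μ` sends them to functions of small norm, uniformly in `ξ` and `t`
(`eventually_orliczModular_carlesonTest_le`). Markov's inequality on the windows gives
`ρ_μ(h) Ψ₂(t / ε) ≤ 1`, which is the limit.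

*Sufficiency.* The main point is that the modulars `∫ Ψ₂(|f| / ε) dμ` over `r < |z| < 1` are at
most one for all `f` in the unit ball, once `r` is near `1`
(`exists_forall_orliczModular_restrict_le`). The hypothesis says that
`Ψ₂(x / ε) ≤ Ψ₁(x) / K(Ψ₁(x)^(-1/2))` for large `x`. The function `Ψ₁(|f|)` is subharmonic, so
`Ψ₁(|f(z)|)` is at most its mean over the disk of centre `z` and radius `(1 - |z|) / 2`, and in
particular `O((1 - |z|)⁻²)`. Hence `Ψ₂(|f(z)| / ε)` is bounded, up to constants, by that mean
divided by `K(c (1 - |z|))`. Integrating against `μ` and exchanging the integrals leaves, for each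
`w`, the measure of the set of `z` whose disk contains `w`. This set lies in a window of size
comparable to `1 - |w|`, so its measure is at most `K` times the square of this size, and the total
is at most a constant times `∫ Ψ₁(|f|) dA` (`lintegral_lintegral_le_of_carlesonK`). Compactness
follows by extracting pointwise convergent subsequences
(`exists_strictMono_tendsto_of_locally_bounded`) and by dominated convergence on `|z| ≤ r`.
-/

/-! ### Orlicz functions and their inverses -/

namespace OrliczFunction

/-- The function `Ψ (|z|)` is convex on the whole plane. Continuity of `Ψ` and Jensen's inequality
for analytic functions both come from this. -/
theorem convexOn_comp_nnnorm (Ψ : OrliczFunction) :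
    ConvexOn ℝ univ (fun z : ℂ => (Ψ ‖z‖₊ : ℝ)) := by
  refine ⟨convex_univ, fun x _ y _ a b ha hb hab => ?_⟩
  lift a to ℝ≥0 using ha
  lift b to ℝ≥0 using hb
  have h := Ψ.convex.2 (mem_univ ‖x‖₊) (mem_univ ‖y‖₊) (zero_le (a := a)) (zero_le (a := b))
    (by exact_mod_cast hab)
  have h1 : Ψ ‖(a : ℝ) • x + (b : ℝ) • y‖₊ ≤ Ψ (a • ‖x‖₊ + b • ‖y‖₊) := by
    refine Ψ.mono ((nnnorm_add_le _ _).trans (le_of_eq ?_))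
    simp
  exact_mod_cast h1.trans h

theorem continuous_comp_nnnorm (Ψ : OrliczFunction) :
    Continuous (fun z : ℂ => (Ψ ‖z‖₊ : ℝ)) :=
  Ψ.convexOn_comp_nnnorm.locallyLipschitz.continuous

theorem continuous (Ψ : OrliczFunction) : Continuous Ψ := by
  have h := Ψ.continuous_comp_nnnorm.comp (Complex.continuous_ofReal.comp NNReal.continuous_coe)
  have h' := continuous_real_toNNReal.comp h
  simpa [Function.comp_def] using h'

theorem le_inv (Ψ : OrliczFunction) {x : ℝ≥0} {y : ℝ≥0∞} (h : (Ψ x : ℝ≥0∞) ≤ y) :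
    (x : ℝ≥0∞) ≤ Ψ.inv y :=
  le_sSup ⟨x, rfl, h⟩

theorem apply_le_of_lt_inv (Ψ : OrliczFunction) {x : ℝ≥0} {y : ℝ≥0∞}
    (h : (x : ℝ≥0∞) < Ψ.inv y) : (Ψ x : ℝ≥0∞) ≤ y := by
  obtain ⟨_, ⟨t, rfl, ht⟩, hx⟩ := lt_sSup_iff.1 h
  exact (ENNReal.coe_le_coe.2 (Ψ.mono (ENNReal.coe_lt_coe.1 hx).le)).trans ht

theorem exists_lt_apply (Ψ : OrliczFunction) (y : ℝ≥0) : ∃ x, 0 < x ∧ y < Ψ x := by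
  obtain ⟨x, h1, h2⟩ := ((eventually_gt_atTop (0 : ℝ≥0)).and
    (Ψ.tendsto_atTop.eventually_gt_atTop y)).exists
  exact ⟨x, h1, h2⟩

theorem inv_ne_top (Ψ : OrliczFunction) {y : ℝ≥0∞} (hy : y ≠ ∞) : Ψ.inv y ≠ ∞ := by
  lift y to ℝ≥0 using hy
  obtain ⟨x, -, hx⟩ := Ψ.exists_lt_apply y
  refine ne_top_of_le_ne_top (ENNReal.coe_ne_top (r := x)) (sSup_le ?_)
  rintro _ ⟨t, rfl, ht⟩
  refine ENNReal.coe_le_coe.2 (le_of_not_gt fun h => ?_)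
  exact absurd ((Ψ.mono h.le).trans (ENNReal.coe_le_coe.1 ht)) hx.not_ge

/-- An Orlicz function grows at least linearly. -/
theorem mul_apply_one_le (Ψ : OrliczFunction) {x : ℝ≥0} (hx : 1 ≤ x) : x * Ψ 1 ≤ Ψ x := by
  have h := Ψ.apply_mul_le (inv_le_one_of_one_le₀ hx) x
  have hx0 : 0 < x := one_pos.trans_le hx
  rwa [inv_mul_cancel₀ hx0.ne', le_inv_mul_iff₀ hx0] at h

end OrliczFunction

/-! ### Modulars and almost everywhere limits -/

section Modular

variable {α : Type*} [MeasurableSpace α] {Ψ : OrliczFunction} {μ : Measure α}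

/-- Fatou's lemma for the modular. -/
theorem orliczModular_le_of_tendsto_ae {f : ℕ → α → ℂ} {g : α → ℂ} {C : ℝ≥0} {M : ℝ≥0∞}
    (hf : ∀ n, AEStronglyMeasurable (f n) μ)
    (hM : ∀ᶠ n in atTop, orliczModular Ψ μ (f n) C ≤ M)
    (hfg : ∀ᵐ x ∂μ, Tendsto (fun n => f n x) atTop (𝓝 (g x))) :
    orliczModular Ψ μ g C ≤ M := by
  calc orliczModular Ψ μ g C
      = ∫⁻ x, liminf (fun n => (Ψ (‖f n x‖₊ / C) : ℝ≥0∞)) atTop ∂μ := by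
        refine lintegral_congr_ae (hfg.mono fun x hx => ?_)
        refine (Tendsto.liminf_eq ?_).symm
        refine ENNReal.tendsto_coe.2 ((Ψ.continuous.tendsto _).comp ?_)
        exact (hx.nnnorm).div_const C
    _ ≤ liminf (fun n => orliczModular Ψ μ (f n) C) atTop :=
        lintegral_liminf_le' fun n => orliczModular_aemeasurable Ψ (hf n) C
    _ ≤ M := by
        refine Filter.liminf_le_of_frequently_le' hM.frequently

namespace OrliczSpace

theorem modular_le_one_of_norm_lt_coe {f : OrliczSpace Ψ μ} {C : ℝ≥0} (h : ‖f‖ < C) :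
    orliczModular Ψ μ (f : α →ₘ[μ] ℂ) C ≤ 1 := by
  simpa using (modular_le_one_of_norm_lt h).2

theorem norm_le_of_modular_coe {f : OrliczSpace Ψ μ} {C : ℝ≥0} (hC : 0 < C)
    (h : orliczModular Ψ μ (f : α →ₘ[μ] ℂ) C ≤ 1) : ‖f‖ ≤ C :=
  norm_le_of_modular (by exact_mod_cast hC) (by simpa using h)

/-- The norm limit of a sequence which converges to zero almost everywhere is zero. -/
theorem eq_zero_of_tendsto_of_tendsto_ae {f : ℕ → OrliczSpace Ψ μ} {g : OrliczSpace Ψ μ}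
    (hfg : Tendsto f atTop (𝓝 g))
    (hf : ∀ᵐ x ∂μ, Tendsto (fun n => (f n : α →ₘ[μ] ℂ) x) atTop (𝓝 0)) : g = 0 := by
  refine norm_eq_zero.1 (le_antisymm (le_of_forall_pos_le_add fun ε hε => ?_) (norm_nonneg _))
  rw [zero_add]
  lift ε to ℝ≥0 using hε.le
  refine norm_le_of_modular_coe (by exact_mod_cast hε) ?_
  have h1 : ∀ᶠ n in atTop, orliczModular Ψ μ ((g - f n : OrliczSpace Ψ μ) : α →ₘ[μ] ℂ) ε ≤ 1 := by
    have h2 : Tendsto (fun n => ‖g - f n‖) atTop (𝓝 0) := by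
      simpa using (tendsto_const_nhds (x := g)).sub hfg |>.norm
    exact (h2.eventually_lt_const hε).mono fun n hn => modular_le_one_of_norm_lt_coe hn
  refine orliczModular_le_of_tendsto_ae (fun n => AEEqFun.aestronglyMeasurable _) h1 ?_
  have h3 : ∀ᵐ x ∂μ, ∀ n, ((g - f n : OrliczSpace Ψ μ) : α →ₘ[μ] ℂ) x
      = (g : α →ₘ[μ] ℂ) x - (f n : α →ₘ[μ] ℂ) x :=
    ae_all_iff.2 fun n => AEEqFun.coeFn_sub _ _
  filter_upwards [hf, h3] with x h4 h5
  simp only [h5]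
  simpa using (tendsto_const_nhds (x := (g : α →ₘ[μ] ℂ) x)).sub h4

end OrliczSpace

end Modular

/-! ### Area mean values of analytic functions -/

theorem intervalIntegral_circleMap_of_diffContOnCl {f : ℂ → ℂ} {c : ℂ} {r : ℝ} (hr : 0 ≤ r)
    (hf : DiffContOnCl ℂ f (Metric.ball c r)) :
    ∫ θ in -Real.pi..Real.pi, f (circleMap c r θ) = (2 * Real.pi) • f c := by
  have h := DiffContOnCl.circleAverage (R := r) (by rwa [abs_of_nonneg hr])
  have hp : Function.Periodic (fun θ => f (circleMap c r θ)) (2 * Real.pi) := fun θ => by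
    simp only [periodic_circleMap c r θ]
  have h2 := hp.intervalIntegral_add_eq (-Real.pi) 0
  rw [zero_add, show -Real.pi + 2 * Real.pi = Real.pi by ring] at h2
  rw [h2, ← h, Real.circleAverage_def, smul_smul, mul_inv_cancel₀ Real.two_pi_pos.ne', one_smul]

/-- The mean value property over a disk: integrate the mean value property over circles in polar
coordinates. -/
theorem setIntegral_ball_of_diffContOnCl {f : ℂ → ℂ} {c : ℂ} {R : ℝ} (hR : 0 < R)
    (hf : DiffContOnCl ℂ f (Metric.ball c R)) :
    ∫ w in Metric.ball c R, f w = (Real.pi * R ^ 2) • f c := by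
  have hpi := Real.pi_pos
  have hcont : ContinuousOn f (Metric.closedBall c R) := by
    simpa [closure_ball c hR.ne'] using hf.continuousOn
  have hcirc : ∀ p : ℝ × ℝ, c + Complex.polarCoord.symm p = circleMap c p.1 p.2 := fun p => by
    simp [Complex.polarCoord_symm_apply, circleMap, Complex.exp_mul_I]
  have hint : IntegrableOn (fun p : ℝ × ℝ => p.1 • f (circleMap c p.1 p.2))
      (Ioo 0 R ×ˢ Ioo (-Real.pi) Real.pi) (volume.prod volume) := by
    have hK : IsCompact (Icc 0 R ×ˢ Icc (-Real.pi) Real.pi) := isCompact_Icc.prod isCompact_Icc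
    refine IntegrableOn.mono_set (ContinuousOn.integrableOn_compact hK ?_)
      (prod_mono Ioo_subset_Icc_self Ioo_subset_Icc_self)
    refine continuousOn_fst.smul (hcont.comp ?_ ?_)
    · have : Continuous fun p : ℝ × ℝ => circleMap c p.1 p.2 := by
        unfold circleMap; fun_prop
      exact this.continuousOn
    · rintro p ⟨hp, -⟩
      simp only [Metric.mem_closedBall, dist_eq_norm, circleMap_sub_center, norm_circleMap_zero,
        abs_of_nonneg hp.1, hp.2]
  calc ∫ w in Metric.ball c R, f w
      = ∫ w, (Metric.ball c R).indicator f (c + w) := by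
        rw [integral_add_left_eq_self, integral_indicator Metric.isOpen_ball.measurableSet]
    _ = ∫ p in polarCoord.target,
          (Ioo 0 R ×ˢ univ).indicator (fun p : ℝ × ℝ => p.1 • f (circleMap c p.1 p.2)) p := by
        rw [← Complex.integral_comp_polarCoord_symm]
        refine setIntegral_congr_fun polarCoord.open_target.measurableSet fun p hp => ?_
        have hp0 : 0 < p.1 := hp.1
        have hmem : c + Complex.polarCoord.symm p ∈ Metric.ball c R ↔ p.1 < R := by
          simp [Complex.norm_polarCoord_symm, abs_of_pos hp0, -Complex.polarCoord_symm_apply]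
        by_cases h : p.1 < R
        · rw [indicator_of_mem (hmem.2 h), indicator_of_mem (show p ∈ Ioo 0 R ×ˢ univ from
            ⟨⟨hp0, h⟩, mem_univ _⟩), hcirc]
        · rw [indicator_of_notMem (mt hmem.1 h), indicator_of_notMem (fun h' => h h'.1.2),
            smul_zero]
    _ = ∫ p in Ioo 0 R ×ˢ Ioo (-Real.pi) Real.pi, p.1 • f (circleMap c p.1 p.2) := by
        rw [setIntegral_indicator (measurableSet_Ioo.prod MeasurableSet.univ)]
        congr 2
        ext p
        simp only [polarCoord_target, mem_inter_iff, mem_prod, mem_Ioi, mem_Ioo, mem_univ]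
        tauto
    _ = ∫ r in Ioo 0 R, ∫ θ in Ioo (-Real.pi) Real.pi, r • f (circleMap c r θ) :=
        setIntegral_prod _ hint
    _ = ∫ r in Ioo 0 R, r • (2 * Real.pi) • f c := by
        refine setIntegral_congr_fun measurableSet_Ioo fun r hr => ?_
        rw [integral_smul, ← integral_Ioc_eq_integral_Ioo,
          ← intervalIntegral.integral_of_le (by linarith),
          intervalIntegral_circleMap_of_diffContOnCl hr.1.le
            (hf.mono (Metric.ball_subset_ball hr.2.le))]
    _ = (Real.pi * R ^ 2) • f c := by
        rw [integral_smul_const, ← integral_Ioc_eq_integral_Ioo,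
          ← intervalIntegral.integral_of_le hR.le, integral_id, smul_smul]
        congr 1
        ring

/-! ### Subharmonicity of `Ψ (|g| / C)` on the disk -/

theorem isOpen_unitDisk : IsOpen unitDisk := Metric.isOpen_ball

theorem mem_unitDisk {z : ℂ} : z ∈ unitDisk ↔ ‖z‖ < 1 := by simp [unitDisk]

theorem lintegral_diskArea (f : ℂ → ℝ≥0∞) :
    ∫⁻ z, f z ∂diskArea = ENNReal.ofReal (1 / Real.pi) * ∫⁻ z in unitDisk, f z := by
  simp [diskArea]

/-- The sub-mean value property of `Ψ (|g| / C)`: apply Jensen's inequality to the mean value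
property of `g`. -/
theorem apply_nnnorm_le_setLIntegral (Ψ : OrliczFunction) {g : ℂ → ℂ}
    (hg : DifferentiableOn ℂ g unitDisk) {z : ℂ} {R : ℝ} (hR : 0 < R) (hz : ‖z‖ + R < 1)
    (C : ℝ≥0) :
    ENNReal.ofReal (R ^ 2) * Ψ (‖g z‖₊ / C) ≤
      ∫⁻ w in Metric.ball z R, Ψ (‖g w‖₊ / C) ∂diskArea := by
  have hpi := Real.pi_pos
  have hsub : Metric.closedBall z R ⊆ unitDisk := fun w hw => by
    rw [mem_unitDisk]
    rw [Metric.mem_closedBall, dist_eq_norm] at hw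
    calc ‖w‖ = ‖(w - z) + z‖ := by simp
      _ ≤ ‖w - z‖ + ‖z‖ := norm_add_le _ _
      _ < 1 := by linarith
  set f : ℂ → ℂ := fun w => g w / ((C : ℝ) : ℂ) with hf
  have hnorm : ∀ w, ‖f w‖₊ = ‖g w‖₊ / C := fun w => by simp [hf, nnnorm_div]
  have hfd : DifferentiableOn ℂ f (Metric.closedBall z R) := (hg.mono hsub).div_const _
  have hfc : DiffContOnCl ℂ f (Metric.ball z R) :=
    ⟨hfd.mono Metric.ball_subset_closedBall, by
      rw [closure_ball z hR.ne']; exact hfd.continuousOn⟩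
  have hvol : (volume : Measure ℂ).real (Metric.ball z R) = Real.pi * R ^ 2 := by
    simp [Measure.real, Complex.volume_ball, hR.le, mul_comm]
  have hpos : 0 < Real.pi * R ^ 2 := by positivity
  have havg : ⨍ w in Metric.ball z R, f w = f z := by
    rw [setAverage_eq, setIntegral_ball_of_diffContOnCl hR hfc, hvol, smul_smul,
      inv_mul_cancel₀ hpos.ne', one_smul]
  have hcpt := isCompact_closedBall z R
  have hint : IntegrableOn f (Metric.ball z R) :=
    (hfd.continuousOn.integrableOn_compact hcpt).mono_set Metric.ball_subset_closedBall
  have hint' : IntegrableOn ((fun z : ℂ => (Ψ ‖z‖₊ : ℝ)) ∘ f) (Metric.ball z R) :=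
    ((Ψ.continuous_comp_nnnorm.comp_continuousOn hfd.continuousOn).integrableOn_compact
      hcpt).mono_set Metric.ball_subset_closedBall
  have : IsFiniteMeasure ((volume : Measure ℂ).restrict (Metric.ball z R)) :=
    ⟨by simpa using measure_ball_lt_top (μ := (volume : Measure ℂ)) (x := z) (r := R)⟩
  have : NeZero ((volume : Measure ℂ).restrict (Metric.ball z R)) :=
    ⟨by simpa [Measure.restrict_eq_zero] using
      (Metric.measure_ball_pos volume z hR).ne'⟩
  have hJ := Ψ.convexOn_comp_nnnorm.map_average_le Ψ.continuous_comp_nnnorm.continuousOn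
    isClosed_univ (Eventually.of_forall fun _ => mem_univ _) hint hint'
  rw [havg, setAverage_eq, hvol, smul_eq_mul, inv_mul_eq_div, le_div_iff₀ hpos] at hJ
  have hJ' := ENNReal.ofReal_le_ofReal hJ
  have hI := ofReal_integral_eq_lintegral_ofReal hint'
    (Eventually.of_forall fun _ => NNReal.coe_nonneg _)
  simp only [Function.comp_apply] at hI
  rw [hI] at hJ'
  simp only [ENNReal.ofReal_coe_nnreal, hnorm] at hJ'
  rw [diskArea, Measure.restrict_smul, lintegral_smul_measure,
    Measure.restrict_restrict Metric.isOpen_ball.measurableSet,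
    inter_eq_self_of_subset_left (Metric.ball_subset_closedBall.trans hsub), smul_eq_mul]
  refine le_trans (le_of_eq ?_) (mul_le_mul_right hJ' _)
  rw [← ENNReal.ofReal_coe_nnreal, ← ENNReal.ofReal_mul (by positivity),
    ← ENNReal.ofReal_mul (by positivity)]
  congr 1
  field_simp

/-! ### The area measure of the disk -/

instance : IsFiniteMeasure diskArea := by
  have : IsFiniteMeasure ((volume : Measure ℂ).restrict unitDisk) := ⟨by simp [unitDisk]⟩
  exact Measure.smul_finite _ ENNReal.ofReal_ne_top

theorem ae_diskArea_mem_unitDisk : ∀ᵐ z ∂diskArea, z ∈ unitDisk :=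
  Measure.ae_smul_measure (ae_restrict_mem isOpen_unitDisk.measurableSet) _

theorem aestronglyMeasurable_of_differentiableOn {μ : Measure ℂ} (hμ : ∀ᵐ z ∂μ, z ∈ unitDisk)
    {g : ℂ → ℂ} (hg : DifferentiableOn ℂ g unitDisk) : AEStronglyMeasurable g μ := by
  rw [← Measure.restrict_eq_self_of_ae_mem hμ]
  exact hg.continuousOn.aestronglyMeasurable isOpen_unitDisk.measurableSet

theorem aestronglyMeasurable_diskArea {g : ℂ → ℂ} (hg : DifferentiableOn ℂ g unitDisk) :
    AEStronglyMeasurable g diskArea :=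
  aestronglyMeasurable_of_differentiableOn ae_diskArea_mem_unitDisk hg

/-! ### Carleson windows and the function `K` -/

theorem carlesonK_mono (μ : Measure ℂ) : Monotone (carlesonK μ) := fun _ _ h =>
  biSup_mono fun _ ht => ⟨ht.1, ht.2.trans_le h⟩

theorem carlesonFunction_le (μ : Measure ℂ) {t h : ℝ} (ht : 0 < t) (hth : t < h) :
    carlesonFunction μ t ≤ carlesonK μ h * ENNReal.ofReal (t ^ 2) := by
  rw [← ENNReal.div_le_iff (ENNReal.ofReal_pos.2 (by positivity)).ne' ENNReal.ofReal_ne_top]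
  exact le_iSup₂ (f := fun t (_ : t ∈ Ioo (0 : ℝ) h) =>
    carlesonFunction μ t / ENNReal.ofReal (t ^ 2)) t ⟨ht, hth⟩

/-- Jordan's inequality `2 |θ| / π ≤ |sin θ|`, applied to the argument of a point close to the
positive real number `a`. -/
theorem abs_arg_le_of_norm_sub_le {u : ℂ} {a s : ℝ} (ha : 3 / 4 ≤ a) (hs : s ≤ 1 / 4)
    (h : ‖u - a‖ ≤ s) : |u.arg| ≤ Real.pi * s := by
  have hpi := Real.pi_pos
  have hre : a - s ≤ u.re := by
    have := (Complex.abs_re_le_norm (u - a)).trans h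
    rw [abs_le] at this
    simp at this
    linarith
  have him : |u.im| ≤ s := by
    have := (Complex.abs_im_le_norm (u - a)).trans h
    simpa using this
  have hnorm : 1 / 2 ≤ ‖u‖ := by
    have := Complex.re_le_norm u
    linarith
  have h1 := Real.mul_abs_le_abs_sin (Complex.abs_arg_le_pi_div_two_iff.2 (by linarith))
  rw [Complex.sin_arg, abs_div, abs_of_nonneg (norm_nonneg u)] at h1
  have h2 : |u.im| / ‖u‖ ≤ 2 * s := by
    rw [div_le_iff₀ (by linarith)]
    nlinarith [abs_nonneg u.im]
  have h3 := h1.trans h2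
  rw [div_mul_eq_mul_div, div_le_iff₀ hpi] at h3
  linarith

/-- The points `z` such that `w` lies in the disk of centre `z` and radius half the distance from
`z` to the unit circle all belong to one Carleson window of size comparable to `1 - |w|`. -/
theorem exists_subset_carlesonWindow {w : ℂ} (hw : w ∈ unitDisk) :
    ∃ ξ ∈ Metric.sphere (0 : ℂ) 1,
      {z : ℂ | ‖w - z‖ < (1 - ‖z‖) / 2} ⊆ carlesonWindow ξ (4 * (1 - ‖w‖)) := by
  rw [mem_unitDisk] at hw
  have hpi := Real.pi_pos
  obtain ⟨ξ, hξ, hwξ⟩ : ∃ ξ : ℂ, ‖ξ‖ = 1 ∧ w = ‖w‖ * ξ := by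
    rcases eq_or_ne w 0 with rfl | hw0
    · exact ⟨1, by simp, by simp⟩
    · have : (‖w‖ : ℂ) ≠ 0 := by simpa using hw0
      exact ⟨w / ‖w‖, by simp [hw0], by field_simp⟩
  refine ⟨ξ, by simpa using hξ, fun z hz => ?_⟩
  have hz' : ‖w - z‖ < (1 - ‖z‖) / 2 := hz
  have h0 := norm_nonneg (w - z)
  have h1 := norm_sub_norm_le w z
  have h2 := norm_sub_norm_le z w
  rw [norm_sub_rev] at h2
  refine ⟨mem_unitDisk.2 (by linarith), by linarith, ?_⟩
  by_cases hs : 1 - ‖w‖ ≤ 1 / 4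
  · have h3 : ‖z * (starRingEnd ℂ) ξ - (‖w‖ : ℝ)‖ ≤ 1 - ‖w‖ := by
      have h4 : (‖w‖ : ℂ) = w * (starRingEnd ℂ) ξ := by
        conv_rhs => rw [hwξ, mul_assoc, Complex.mul_conj, Complex.normSq_eq_norm_sq, hξ]
        simp
      rw [h4, ← sub_mul, norm_mul, RCLike.norm_conj, hξ, mul_one, norm_sub_rev]
      linarith
    refine (abs_arg_le_of_norm_sub_le (by linarith) hs h3).trans ?_
    nlinarith
  · refine (Complex.abs_arg_le_pi _).trans ?_
    nlinarith

/-- The measure estimate used for fixed `w` after exchanging the integrals in `z` and `w`. -/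
theorem measure_le_carlesonK (μ : Measure ℂ) {w : ℂ} (hw : w ∈ unitDisk) {h : ℝ}
    (hh : 4 * (1 - ‖w‖) < h) :
    μ {z : ℂ | ‖w - z‖ < (1 - ‖z‖) / 2} ≤
      carlesonK μ h * ENNReal.ofReal (16 * (1 - ‖w‖) ^ 2) := by
  obtain ⟨ξ, hξ, hsub⟩ := exists_subset_carlesonWindow hw
  rw [mem_unitDisk] at hw
  calc μ {z : ℂ | ‖w - z‖ < (1 - ‖z‖) / 2}
      ≤ μ (carlesonWindow ξ (4 * (1 - ‖w‖))) := measure_mono hsub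
    _ ≤ carlesonFunction μ (4 * (1 - ‖w‖)) :=
        le_iSup₂ (f := fun ξ (_ : ξ ∈ Metric.sphere (0 : ℂ) 1) =>
          μ (carlesonWindow ξ (4 * (1 - ‖w‖)))) ξ hξ
    _ ≤ carlesonK μ h * ENNReal.ofReal ((4 * (1 - ‖w‖)) ^ 2) :=
        carlesonFunction_le μ (by linarith) hh
    _ = _ := by congr 2; ring

/-- The limit condition, rewritten as a growth comparison of the two Orlicz functions: for large
`x`, the quotient is evaluated at `k = Ψ₁(x)^(-1/2)`, so that `1 / k² = Ψ₁ x`. -/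
theorem exists_forall_apply_div_le {μ : Measure ℂ} {Ψ₁ Ψ₂ : OrliczFunction}
    (hlim : Tendsto (fun h : ℝ => Ψ₁.inv (1 / ENNReal.ofReal (h ^ 2)) /
        Ψ₂.inv (1 / (ENNReal.ofReal (h ^ 2) * carlesonK μ h))) (𝓝[>] 0) (𝓝 0))
    {ε : ℝ≥0} (hε : 0 < ε) :
    ∃ N : ℝ≥0, ∀ x : ℝ≥0, N < Ψ₁ x → ∀ h : ℝ, 0 < h → (Ψ₁ x : ℝ) ≤ 1 / h ^ 2 →
      (Ψ₂ (x / ε) : ℝ≥0∞) ≤ (carlesonK μ h)⁻¹ * Ψ₁ x := by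
  have hev := hlim.eventually_lt_const (ENNReal.coe_pos.2 hε)
  obtain ⟨h₀, hh₀, hsub⟩ := mem_nhdsGT_iff_exists_Ioo_subset.1 hev
  have hh₀ : 0 < h₀ := hh₀
  refine ⟨(1 / h₀ ^ 2).toNNReal, fun x hx h hh hxh => ?_⟩
  rw [Real.toNNReal_lt_iff_lt_coe (by positivity)] at hx
  have hpos : (0 : ℝ) < Ψ₁ x := lt_trans (by positivity) hx
  have hx0 : x ≠ 0 := by rintro rfl; simp [Ψ₁.map_zero] at hpos
  set k : ℝ := 1 / Real.sqrt (Ψ₁ x) with hk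
  have hk0 : 0 < k := by positivity
  have hk2 : k ^ 2 = 1 / (Ψ₁ x : ℝ) := by rw [hk, div_pow, Real.sq_sqrt hpos.le, one_pow]
  have hkh₀ : k < h₀ := by
    refine lt_of_pow_lt_pow_left₀ 2 hh₀.le ?_
    rw [hk2, one_div_lt hpos (by positivity)]
    exact hx
  have hhk : h ≤ k := by
    refine le_of_sq_le_sq ?_ hk0.le
    rw [hk2, le_one_div (by positivity) hpos]
    exact hxh
  have hinv : (1 / ENNReal.ofReal (k ^ 2) : ℝ≥0∞) = Ψ₁ x := by
    rw [hk2, one_div, one_div, ENNReal.ofReal_inv_of_pos hpos, inv_inv,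
      ENNReal.ofReal_coe_nnreal]
  have hlt := hsub ⟨hk0, hkh₀⟩
  simp only [mem_ofPred_eq] at hlt
  have hle := Ψ₁.le_inv hinv.ge
  have hne : Ψ₁.inv (1 / ENNReal.ofReal (k ^ 2)) ≠ 0 := by
    intro h0
    rw [h0] at hle
    simp [hx0] at hle
  rw [ENNReal.div_lt_iff (Or.inr hne) (Or.inr (Ψ₁.inv_ne_top (by rw [hinv]; simp)))] at hlt
  have hlt' := hle.trans_lt hlt
  have hxε : ((x / ε : ℝ≥0) : ℝ≥0∞) <
      Ψ₂.inv (1 / (ENNReal.ofReal (k ^ 2) * carlesonK μ k)) := by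
    rw [ENNReal.coe_div hε.ne', ENNReal.div_lt_iff (by simp [hε.ne']) (by simp), mul_comm]
    exact hlt'
  refine (Ψ₂.apply_le_of_lt_inv hxε).trans ?_
  rw [one_div, ENNReal.mul_inv (Or.inl ?_) (Or.inl ENNReal.ofReal_ne_top), ← one_div, hinv,
    mul_comm]
  · gcongr
    exact carlesonK_mono μ hhk
  · exact (ENNReal.ofReal_pos.2 (by positivity)).ne'

/-! ### The Carleson embedding -/

/-- The Carleson embedding behind the compactness: Fubini's theorem turns the averages of `Φ` over
the disks of centre `z` and radius `(1 - |z|) / 2` into the `μ`-measures of Carleson windows, which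
the weight `1 / K` compensates. The factor `10` is large enough: for a given `w` the points `z` that
contribute satisfy `10 (1 - |z|) ≥ 20 (1 - |w|) / 3 > 4 (1 - |w|)`, and `4 (1 - |w|)` is the size of
the window which contains them. -/
theorem lintegral_lintegral_le_of_carlesonK (μ : Measure ℂ) [IsFiniteMeasure μ] {Φ : ℂ → ℝ≥0∞}
    (hΦ : AEMeasurable Φ diskArea) :
    ∫⁻ z, (carlesonK μ (10 * (1 - ‖z‖)))⁻¹ * (ENNReal.ofReal (1 / (100 * (1 - ‖z‖) ^ 2)) *
      ∫⁻ w in Metric.ball z ((1 - ‖z‖) / 2), Φ w ∂diskArea) ∂μ ≤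
        ENNReal.ofReal (1 / 2) * ∫⁻ w, Φ w ∂diskArea := by
  set S : Set (ℂ × ℂ) := {p | ‖p.2 - p.1‖ < (1 - ‖p.1‖) / 2} with hS
  have hSm : MeasurableSet S := measurableSet_lt (by fun_prop) (by fun_prop)
  set c : ℂ → ℝ≥0∞ := fun z =>
    (carlesonK μ (10 * (1 - ‖z‖)))⁻¹ * ENNReal.ofReal (1 / (100 * (1 - ‖z‖) ^ 2)) with hc
  have hcm : Measurable c :=
    ((carlesonK_mono μ).measurable.comp (by fun_prop)).inv.mul (by fun_prop)
  set k : ℂ → ℂ → ℝ≥0∞ := fun z w => S.indicator (fun p => c p.1) (z, w) * Φ w with hk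
  have hkm : AEMeasurable (Function.uncurry k) (μ.prod diskArea) :=
    ((hcm.comp measurable_fst).indicator hSm).aemeasurable.mul hΦ.comp_snd
  calc ∫⁻ z, (carlesonK μ (10 * (1 - ‖z‖)))⁻¹ * (ENNReal.ofReal (1 / (100 * (1 - ‖z‖) ^ 2)) *
      ∫⁻ w in Metric.ball z ((1 - ‖z‖) / 2), Φ w ∂diskArea) ∂μ
      = ∫⁻ z, ∫⁻ w, k z w ∂diskArea ∂μ := by
        refine lintegral_congr fun z => ?_
        rw [← mul_assoc, ← lintegral_indicator Metric.isOpen_ball.measurableSet,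
          ← lintegral_const_mul'' (c z) (hΦ.indicator Metric.isOpen_ball.measurableSet)]
        refine lintegral_congr fun w => ?_
        by_cases hw : w ∈ Metric.ball z ((1 - ‖z‖) / 2)
        · have : (z, w) ∈ S := by rwa [Metric.mem_ball, dist_eq_norm] at hw
          simp only [hk, indicator_of_mem hw, indicator_of_mem this]
        · have : (z, w) ∉ S := by rwa [Metric.mem_ball, dist_eq_norm] at hw
          simp only [hk, indicator_of_notMem hw, indicator_of_notMem this, mul_zero, zero_mul]
    _ = ∫⁻ w, ∫⁻ z, k z w ∂μ ∂diskArea := lintegral_lintegral_swap hkm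
    _ ≤ ∫⁻ w, ENNReal.ofReal (1 / 2) * Φ w ∂diskArea := by
        refine lintegral_mono_ae (ae_diskArea_mem_unitDisk.mono fun w hw => ?_)
        have hw1 := mem_unitDisk.1 hw
        have hSw : MeasurableSet {z : ℂ | ‖w - z‖ < (1 - ‖z‖) / 2} :=
          measurableSet_lt (by fun_prop) (by fun_prop)
        have hm : Measurable fun z => S.indicator (fun p => c p.1) (z, w) :=
          ((hcm.comp measurable_fst).indicator hSm).comp (by fun_prop)
        simp only [hk]
        rw [lintegral_mul_const _ hm]
        gcongr
        set c₀ : ℝ≥0∞ := (carlesonK μ (20 * (1 - ‖w‖) / 3))⁻¹ *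
          ENNReal.ofReal (9 / (400 * (1 - ‖w‖) ^ 2)) with hc₀
        calc ∫⁻ z, S.indicator (fun p => c p.1) (z, w) ∂μ
            ≤ ∫⁻ z, {z : ℂ | ‖w - z‖ < (1 - ‖z‖) / 2}.indicator (fun _ => c₀) z ∂μ := by
              refine lintegral_mono fun z => ?_
              by_cases hz : ‖w - z‖ < (1 - ‖z‖) / 2
              · rw [indicator_of_mem (show (z, w) ∈ S from hz),
                  indicator_of_mem (show z ∈ {z : ℂ | ‖w - z‖ < (1 - ‖z‖) / 2} from hz)]
                have h2 := norm_sub_norm_le z w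
                rw [norm_sub_rev] at h2
                have h3 : 2 * (1 - ‖w‖) / 3 ≤ 1 - ‖z‖ := by linarith
                have h4 : 0 < 1 - ‖w‖ := by linarith
                have h5 : 0 < 1 - ‖z‖ := by linarith
                simp only [hc, hc₀]
                gcongr ?_⁻¹ * ENNReal.ofReal ?_
                · exact carlesonK_mono μ (by linarith)
                · rw [div_le_div_iff₀ (by positivity) (by positivity)]
                  nlinarith
              · rw [indicator_of_notMem (show (z, w) ∉ S from hz)]
                exact zero_le
          _ = c₀ * μ {z : ℂ | ‖w - z‖ < (1 - ‖z‖) / 2} := by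
              rw [lintegral_indicator hSw, setLIntegral_const]
          _ ≤ c₀ * (carlesonK μ (20 * (1 - ‖w‖) / 3) * ENNReal.ofReal (16 * (1 - ‖w‖) ^ 2)) := by
              gcongr
              exact measure_le_carlesonK μ hw (by linarith)
          _ = ((carlesonK μ (20 * (1 - ‖w‖) / 3))⁻¹ * carlesonK μ (20 * (1 - ‖w‖) / 3)) *
              (ENNReal.ofReal (9 / (400 * (1 - ‖w‖) ^ 2)) *
                ENNReal.ofReal (16 * (1 - ‖w‖) ^ 2)) := by rw [hc₀]; ring
          _ ≤ 1 * ENNReal.ofReal (1 / 2) := by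
              gcongr
              · exact ENNReal.inv_mul_le_one _
              · have h4 : 0 < 1 - ‖w‖ := by linarith
                rw [← ENNReal.ofReal_mul (by positivity)]
                refine ENNReal.ofReal_le_ofReal ?_
                rw [div_mul_eq_mul_div, div_le_div_iff₀ (by positivity) (by positivity)]
                nlinarith [sq_nonneg (1 - ‖w‖)]
          _ = ENNReal.ofReal (1 / 2) := one_mul _
    _ = ENNReal.ofReal (1 / 2) * ∫⁻ w, Φ w ∂diskArea := lintegral_const_mul'' _ hΦ

/-- The mass of the annuli `r < |z| < 1` is small for `r` near `1`. -/
theorem exists_mul_measure_le {μ : Measure ℂ} [IsFiniteMeasure μ] (hμ : μ unitDiskᶜ = 0)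
    (a : ℝ≥0) {δ : ℝ≥0∞} (hδ : 0 < δ) :
    ∃ r : ℝ, r < 1 ∧ a * μ {z : ℂ | r < ‖z‖} ≤ δ := by
  have h1 : Tendsto (fun n : ℕ => μ {z : ℂ | 1 - 1 / ((n : ℝ) + 1) < ‖z‖}) atTop
      (𝓝 (μ (⋂ n : ℕ, {z : ℂ | 1 - 1 / ((n : ℝ) + 1) < ‖z‖}))) := by
    refine tendsto_measure_iInter_atTop
      (fun n => (measurableSet_lt measurable_const measurable_norm).nullMeasurableSet) ?_
      ⟨0, measure_ne_top _ _⟩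
    intro m n hmn z hz
    simp only [mem_ofPred_eq] at hz ⊢
    refine lt_of_le_of_lt ?_ hz
    gcongr
  have h2 : μ (⋂ n : ℕ, {z : ℂ | 1 - 1 / ((n : ℝ) + 1) < ‖z‖}) = 0 := by
    refine measure_mono_null (fun z hz => ?_) hμ
    rw [mem_compl_iff, mem_unitDisk, not_lt]
    refine le_of_forall_pos_lt_add fun η hη => ?_
    obtain ⟨n, hn⟩ := exists_nat_one_div_lt hη
    have := mem_iInter.1 hz n
    simp only [mem_ofPred_eq] at this
    linarith
  rw [h2] at h1
  have h3 := ENNReal.Tendsto.const_mul h1 (Or.inr (ENNReal.coe_ne_top (r := a)))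
  rw [mul_zero] at h3
  obtain ⟨n, hn⟩ := (h3.eventually_lt_const hδ).exists
  exact ⟨_, sub_lt_self _ (by positivity), hn.le⟩

/-- Growth of the functions of the unit ball of the Bergman-Orlicz space. -/
theorem apply_nnnorm_le_of_modular_le_one {Ψ : OrliczFunction} {g : ℂ → ℂ}
    (hg : DifferentiableOn ℂ g unitDisk) {C : ℝ≥0} (hC : orliczModular Ψ diskArea g C ≤ 1) {z : ℂ}
    (hz : z ∈ unitDisk) : (Ψ (‖g z‖₊ / C) : ℝ) ≤ 4 / (1 - ‖z‖) ^ 2 := by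
  rw [mem_unitDisk] at hz
  have hR : 0 < (1 - ‖z‖) / 2 := by linarith
  have h := (apply_nnnorm_le_setLIntegral Ψ hg (z := z) hR (by linarith) C).trans
    ((setLIntegral_le_lintegral _ _).trans hC)
  rw [← ENNReal.ofReal_coe_nnreal, ← ENNReal.ofReal_mul (by positivity), ENNReal.ofReal_le_one] at h
  rw [le_div_iff₀ (by nlinarith)]
  nlinarith

/-- On the unit ball of the Bergman-Orlicz space the modulars near the unit circle are uniformly
small. -/
theorem exists_forall_orliczModular_restrict_le {μ : Measure ℂ} [IsFiniteMeasure μ]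
    (hμ : μ unitDiskᶜ = 0) {Ψ₁ Ψ₂ : OrliczFunction}
    (hlim : Tendsto (fun h : ℝ => Ψ₁.inv (1 / ENNReal.ofReal (h ^ 2)) /
        Ψ₂.inv (1 / (ENNReal.ofReal (h ^ 2) * carlesonK μ h))) (𝓝[>] 0) (𝓝 0))
    {ε : ℝ≥0} (hε : 0 < ε) :
    ∃ r : ℝ, r < 1 ∧ ∀ (g : ℂ → ℂ) (C : ℝ≥0), DifferentiableOn ℂ g unitDisk →
      orliczModular Ψ₁ diskArea g C ≤ 1 →
      orliczModular Ψ₂ (μ.restrict {z | r < ‖z‖}) g (ε * C) ≤ 1 := by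
  -- Dividing `g` by `400` turns the growth bound `4 / (1 - |z|)²` into `1 / (10 (1 - |z|))²`, the
  -- form in which the comparison of `Ψ₁` and `Ψ₂` meets the weight of the Carleson embedding.
  have hε' : 0 < ε / 400 := by positivity
  obtain ⟨N, hN⟩ := exists_forall_apply_div_le hlim hε'
  obtain ⟨x₀, -, hx₀⟩ := Ψ₁.exists_lt_apply N
  have hhalf : 0 < ENNReal.ofReal (1 / 2) := by simp
  obtain ⟨r, hr1, hr⟩ := exists_mul_measure_le hμ (Ψ₂ (x₀ / (ε / 400))) hhalf
  refine ⟨r, hr1, fun g C hg hgC => ?_⟩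
  set F : ℂ → ℝ≥0∞ := fun z => (carlesonK μ (10 * (1 - ‖z‖)))⁻¹ *
    (ENNReal.ofReal (1 / (100 * (1 - ‖z‖) ^ 2)) *
      ∫⁻ w in Metric.ball z ((1 - ‖z‖) / 2), Ψ₁ (‖g w‖₊ / C) ∂diskArea) with hF
  have hpt : ∀ z ∈ unitDisk,
      (Ψ₂ (‖g z‖₊ / (ε * C)) : ℝ≥0∞) ≤ Ψ₂ (x₀ / (ε / 400)) + F z := by
    intro z hz
    set x : ℝ≥0 := 400⁻¹ * (‖g z‖₊ / C) with hx
    have hxε : ‖g z‖₊ / (ε * C) = x / (ε / 400) := by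
      rw [hx, div_eq_mul_inv, div_eq_mul_inv, div_eq_mul_inv, div_eq_mul_inv, mul_inv, mul_inv,
        inv_inv]
      calc ‖g z‖₊ * (ε⁻¹ * C⁻¹) = (400⁻¹ * 400) * (‖g z‖₊ * (ε⁻¹ * C⁻¹)) := by
            rw [inv_mul_cancel₀ (by norm_num), one_mul]
        _ = _ := by ring
    rw [hxε]
    have hΨx : Ψ₁ x ≤ 400⁻¹ * Ψ₁ (‖g z‖₊ / C) :=
      Ψ₁.apply_mul_le (inv_le_one_of_one_le₀ (by norm_num)) _
    rcases le_or_gt (Ψ₁ x) N with hxN | hxN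
    -- Small values are controlled by the small mass near the circle, large values by the embedding.
    · refine le_add_right (ENNReal.coe_le_coe.2 (Ψ₂.mono ?_))
      gcongr
      exact le_of_not_gt fun h => (hxN.trans_lt hx₀).not_ge (Ψ₁.mono h.le)
    · refine le_add_left ?_
      have hz1 : 0 < 1 - ‖z‖ := by have := mem_unitDisk.1 hz; linarith
      have hΨx' : (Ψ₁ x : ℝ) ≤ 400⁻¹ * Ψ₁ (‖g z‖₊ / C) := by exact_mod_cast hΨx
      refine (hN x hxN (10 * (1 - ‖z‖)) (by positivity) ?_).trans ?_
      · have h := apply_nnnorm_le_of_modular_le_one hg hgC hz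
        calc (Ψ₁ x : ℝ) ≤ 400⁻¹ * (4 / (1 - ‖z‖) ^ 2) := by linarith
          _ = 1 / (10 * (1 - ‖z‖)) ^ 2 := by field_simp; norm_num
      · refine mul_le_mul_right ?_ _
        have h := apply_nnnorm_le_setLIntegral Ψ₁ hg (z := z) (R := (1 - ‖z‖) / 2) (by positivity)
          (by linarith) C
        refine le_trans ?_ (mul_le_mul_right h _)
        rw [← mul_assoc, ← ENNReal.ofReal_mul (by positivity), ← ENNReal.ofReal_coe_nnreal,
          ← ENNReal.ofReal_coe_nnreal, ← ENNReal.ofReal_mul (by positivity)]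
        refine ENNReal.ofReal_le_ofReal (hΨx'.trans (le_of_eq ?_))
        field_simp
        ring
  have hΦ : AEMeasurable (fun w => (Ψ₁ (‖g w‖₊ / C) : ℝ≥0∞)) diskArea :=
    orliczModular_aemeasurable Ψ₁ (aestronglyMeasurable_diskArea hg) C
  have hae : ∀ᵐ z ∂μ.restrict {z | r < ‖z‖}, z ∈ unitDisk := ae_restrict_of_ae hμ
  calc orliczModular Ψ₂ (μ.restrict {z | r < ‖z‖}) g (ε * C)
      ≤ ∫⁻ z in {z | r < ‖z‖}, (Ψ₂ (x₀ / (ε / 400)) + F z) ∂μ :=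
        lintegral_mono_ae (hae.mono hpt)
    _ = Ψ₂ (x₀ / (ε / 400)) * μ {z | r < ‖z‖} + ∫⁻ z in {z | r < ‖z‖}, F z ∂μ := by
        rw [lintegral_add_left measurable_const, setLIntegral_const]
    _ ≤ ENNReal.ofReal (1 / 2) + ENNReal.ofReal (1 / 2) * 1 := by
        refine add_le_add hr ((setLIntegral_le_lintegral _ _).trans ?_)
        exact (lintegral_lintegral_le_of_carlesonK μ hΦ).trans (mul_le_mul_right hgC _)
    _ = 1 := by
        rw [mul_one, ← ENNReal.ofReal_add (by norm_num) (by norm_num)]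
        norm_num

/-! ### Locally bounded sequences of analytic functions -/

/-- Cauchy's estimate for the Taylor coefficients at the origin. -/
theorem norm_coeff_le {f : ℂ → ℂ} (hf : DifferentiableOn ℂ f unitDisk) {r B : ℝ} (hr0 : 0 < r)
    (hr : r < 1) (hB : ∀ z, ‖z‖ ≤ r → ‖f z‖ ≤ B) (k : ℕ) :
    ‖(k.factorial : ℂ)⁻¹ * iteratedDeriv k f 0‖ ≤ B / r ^ k := by
  have hfc : DiffContOnCl ℂ f (Metric.ball 0 r) := by
    refine DifferentiableOn.diffContOnCl (hf.mono fun z hz => ?_)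
    rw [closure_ball _ hr0.ne', mem_closedBall_zero_iff] at hz
    exact mem_unitDisk.2 (hz.trans_lt hr)
  have h := Complex.norm_iteratedDeriv_le_of_forall_mem_sphere_norm_le k hr0 hfc
    (fun z hz => hB z (by simpa using (mem_sphere_zero_iff_norm.1 hz).le))
  have hk : (0 : ℝ) < k.factorial := by exact_mod_cast k.factorial_pos
  rw [norm_mul, norm_inv, Complex.norm_natCast, inv_mul_le_iff₀ hk]
  exact h.trans (le_of_eq (by ring))

/-- Montel's theorem on the disk, with pointwise convergence: by Cauchy's estimates the sequences of
Taylor coefficients lie in a compact product of disks, and convergence of the coefficients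
gives convergence of the functions by dominated convergence of the series. -/
theorem exists_strictMono_tendsto_of_locally_bounded {f : ℕ → ℂ → ℂ}
    (hf : ∀ n, DifferentiableOn ℂ (f n) unitDisk)
    (hb : ∀ r < 1, ∃ B : ℝ, ∀ n z, ‖z‖ ≤ r → ‖f n z‖ ≤ B) :
    ∃ (g : ℂ → ℂ) (φ : ℕ → ℕ), DifferentiableOn ℂ g unitDisk ∧ StrictMono φ ∧
      ∀ z ∈ unitDisk, Tendsto (fun n => f (φ n) z) atTop (𝓝 (g z)) := by
  set a : ℕ → ℕ → ℂ := fun n k => (k.factorial : ℂ)⁻¹ * iteratedDeriv k (f n) 0 with ha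
  have ha_le : ∀ r : ℝ, 0 < r → r < 1 → ∃ B : ℝ, ∀ n k, ‖a n k‖ ≤ B / r ^ k := fun r h0 h1 => by
    obtain ⟨B, hB⟩ := hb r h1
    exact ⟨B, fun n k => norm_coeff_le (hf n) h0 h1 (hB n) k⟩
  obtain ⟨B₀, hB₀⟩ := ha_le (1 / 2) (by norm_num) (by norm_num)
  have hcpt : IsCompact (univ.pi fun k : ℕ => Metric.closedBall (0 : ℂ) (B₀ / (1 / 2) ^ k)) :=
    isCompact_univ_pi fun k => isCompact_closedBall _ _
  obtain ⟨b, -, φ, hφ, hlim⟩ := hcpt.isSeqCompact (x := a)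
    (fun n k _ => by simpa using hB₀ n k)
  have hlim' : ∀ k, Tendsto (fun n => a (φ n) k) atTop (𝓝 (b k)) := tendsto_pi_nhds.1 hlim
  have key : ∀ ρ : ℝ, 0 ≤ ρ → ρ < 1 → ∃ u : ℕ → ℝ, Summable u ∧
      (∀ n k, ∀ z : ℂ, ‖z‖ ≤ ρ → ‖a n k * z ^ k‖ ≤ u k) ∧
      ∀ k, ∀ z : ℂ, ‖z‖ ≤ ρ → ‖b k * z ^ k‖ ≤ u k := by
    intro ρ h0 h1
    have hr0 : 0 < (1 + ρ) / 2 := by linarith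
    obtain ⟨B, hB⟩ := ha_le ((1 + ρ) / 2) hr0 (by linarith)
    have hbnd : ∀ c : ℂ, ∀ k, ‖c‖ ≤ B / ((1 + ρ) / 2) ^ k → ∀ z : ℂ, ‖z‖ ≤ ρ →
        ‖c * z ^ k‖ ≤ B * (ρ / ((1 + ρ) / 2)) ^ k := by
      intro c k hc z hz
      rw [norm_mul, norm_pow]
      calc ‖c‖ * ‖z‖ ^ k ≤ B / ((1 + ρ) / 2) ^ k * ρ ^ k := by
            gcongr
            exact (norm_nonneg _).trans hc
        _ = _ := by rw [div_pow ρ]; ring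
    refine ⟨fun k => B * (ρ / ((1 + ρ) / 2)) ^ k, ?_, fun n k => hbnd _ k (hB n k), fun k =>
      hbnd _ k (le_of_tendsto (hlim' k).norm (Eventually.of_forall fun n => hB (φ n) k))⟩
    refine (summable_geometric_of_lt_one (by positivity) ?_).mul_left B
    rw [div_lt_one hr0]
    linarith
  refine ⟨fun z => ∑' k, b k * z ^ k, φ, fun z hz => ?_, hφ, fun z hz => ?_⟩
  · rw [mem_unitDisk] at hz
    obtain ⟨ρ, hzρ, hρ⟩ := exists_between hz
    obtain ⟨u, hu, -, hbu⟩ := key ρ ((norm_nonneg z).trans hzρ.le) hρ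
    have hd : DifferentiableOn ℂ (fun z => ∑' k, b k * z ^ k) (Metric.ball 0 ρ) :=
      Complex.differentiableOn_tsum_of_summable_norm hu (fun k => by fun_prop) Metric.isOpen_ball
        fun k w hw => hbu k w (mem_ball_zero_iff.1 hw).le
    exact (hd.differentiableAt (Metric.isOpen_ball.mem_nhds
      (mem_ball_zero_iff.2 hzρ))).differentiableWithinAt
  · obtain ⟨u, hu, hau, -⟩ := key ‖z‖ (norm_nonneg z) (mem_unitDisk.1 hz)
    have hsum : ∀ n, f n z = ∑' k, a n k * z ^ k := fun n => by
      simpa [ha] using (Complex.taylorSeries_eq_on_ball' hz (hf n)).symm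
    simp only [hsum]
    exact tendsto_tsum_of_dominated_convergence hu (fun k => (hlim' k).mul_const _)
      (Eventually.of_forall fun n k => hau (φ n) k z le_rfl)

/-- The unit ball of the Bergman-Orlicz space is uniformly bounded on each disk of
radius `r < 1`. -/
theorem exists_norm_le_of_modular_le_one (Ψ : OrliczFunction) {C : ℝ≥0} (hC : 0 < C) {r : ℝ}
    (hr : r < 1) : ∃ B : ℝ≥0, ∀ g : ℂ → ℂ, DifferentiableOn ℂ g unitDisk →
      orliczModular Ψ diskArea g C ≤ 1 → ∀ z, ‖z‖ ≤ r → ‖g z‖₊ ≤ B := by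
  obtain ⟨x, -, hx⟩ := Ψ.exists_lt_apply (4 / (1 - r) ^ 2).toNNReal
  refine ⟨x * C, fun g hg hgC z hz => ?_⟩
  rw [← div_le_iff₀ hC]
  refine le_of_not_gt fun h => ?_
  have h1 := apply_nnnorm_le_of_modular_le_one hg hgC (mem_unitDisk.2 (hz.trans_lt hr))
  have h2 : (4 : ℝ) / (1 - ‖z‖) ^ 2 ≤ 4 / (1 - r) ^ 2 := by
    have : 0 < 1 - r := by linarith
    gcongr
  rw [Real.toNNReal_lt_iff_lt_coe (by positivity)] at hx
  have h3 : (Ψ x : ℝ) ≤ Ψ (‖g z‖₊ / C) := by exact_mod_cast Ψ.mono h.le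
  linarith

/-! ### The Bergman-Orlicz space and the canonical map -/

theorem eqOn_unitDisk_of_ae_eq {g₁ g₂ : ℂ → ℂ} (h₁ : DifferentiableOn ℂ g₁ unitDisk)
    (h₂ : DifferentiableOn ℂ g₂ unitDisk) (h : g₁ =ᵐ[diskArea] g₂) : EqOn g₁ g₂ unitDisk := by
  refine Measure.eqOn_open_of_ae_eq (μ := volume) ?_ isOpen_unitDisk h₁.continuousOn h₂.continuousOn
  rw [diskArea, EventuallyEq, Measure.ae_ennreal_smul_measure_iff] at h
  · exact h
  · simp [Real.pi_pos]

namespace BergmanOrlicz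

variable {Ψ : OrliczFunction}

/-- The analytic function of which an element of the Bergman-Orlicz space is the class. -/
noncomputable def rep (f : BergmanOrlicz Ψ) : ℂ → ℂ := f.2.choose

theorem differentiableOn_rep (f : BergmanOrlicz Ψ) : DifferentiableOn ℂ (rep f) unitDisk :=
  f.2.choose_spec.1

theorem coeFn_ae_eq_rep (f : BergmanOrlicz Ψ) :
    (((f : OrliczSpace Ψ diskArea) : ℂ →ₘ[diskArea] ℂ) : ℂ → ℂ) =ᵐ[diskArea] rep f :=
  f.2.choose_spec.2

theorem eqOn_rep (f : BergmanOrlicz Ψ) {g : ℂ → ℂ} (hg : DifferentiableOn ℂ g unitDisk)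
    (h : (((f : OrliczSpace Ψ diskArea) : ℂ →ₘ[diskArea] ℂ) : ℂ → ℂ) =ᵐ[diskArea] g) :
    EqOn (rep f) g unitDisk :=
  eqOn_unitDisk_of_ae_eq (differentiableOn_rep f) hg ((coeFn_ae_eq_rep f).symm.trans h)

theorem eqOn_rep_add (f g : BergmanOrlicz Ψ) : EqOn (rep (f + g)) (rep f + rep g) unitDisk :=
  eqOn_rep _ ((differentiableOn_rep f).add (differentiableOn_rep g))
    ((AEEqFun.coeFn_add _ _).trans ((coeFn_ae_eq_rep f).add (coeFn_ae_eq_rep g)))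

theorem eqOn_rep_sub (f g : BergmanOrlicz Ψ) : EqOn (rep (f - g)) (rep f - rep g) unitDisk :=
  eqOn_rep _ ((differentiableOn_rep f).sub (differentiableOn_rep g))
    ((AEEqFun.coeFn_sub _ _).trans ((coeFn_ae_eq_rep f).sub (coeFn_ae_eq_rep g)))

theorem eqOn_rep_smul (c : ℂ) (f : BergmanOrlicz Ψ) : EqOn (rep (c • f)) (c • rep f) unitDisk :=
  eqOn_rep _ ((differentiableOn_rep f).const_smul c)
    ((AEEqFun.coeFn_smul c _).trans ((coeFn_ae_eq_rep f).const_smul c))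

theorem modular_rep_le_one {f : BergmanOrlicz Ψ} {C : ℝ≥0} (h : ‖f‖ < C) :
    orliczModular Ψ diskArea (rep f) C ≤ 1 := by
  rw [← orliczModular_congr Ψ (coeFn_ae_eq_rep f)]
  exact OrliczSpace.modular_le_one_of_norm_lt_coe h

/-- The class of an analytic function of finite modular. -/
noncomputable def mk (g : ℂ → ℂ) (hg : DifferentiableOn ℂ g unitDisk)
    (h : ∃ C : ℝ≥0, 0 < C ∧ orliczModular Ψ diskArea g C < ∞) : BergmanOrlicz Ψ :=
  ⟨⟨AEEqFun.mk g (aestronglyMeasurable_diskArea hg), by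
    obtain ⟨C, hC, h⟩ := h
    exact ⟨C, hC, by rwa [orliczModular_congr Ψ (AEEqFun.coeFn_mk g _)]⟩⟩,
    g, hg, AEEqFun.coeFn_mk g _⟩

theorem coeFn_mk {g : ℂ → ℂ} (hg : DifferentiableOn ℂ g unitDisk)
    (h : ∃ C : ℝ≥0, 0 < C ∧ orliczModular Ψ diskArea g C < ∞) :
    (((mk g hg h : OrliczSpace Ψ diskArea) : ℂ →ₘ[diskArea] ℂ) : ℂ → ℂ) =ᵐ[diskArea] g :=
  AEEqFun.coeFn_mk g _

theorem norm_mk_le {g : ℂ → ℂ} (hg : DifferentiableOn ℂ g unitDisk)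
    (h : ∃ C : ℝ≥0, 0 < C ∧ orliczModular Ψ diskArea g C < ∞) {C : ℝ≥0} (hC : 0 < C)
    (hgC : orliczModular Ψ diskArea g C ≤ 1) : ‖(mk g hg h : BergmanOrlicz Ψ)‖ ≤ C := by
  refine OrliczSpace.norm_le_of_modular_coe hC ?_
  exact (orliczModular_congr Ψ (coeFn_mk hg h) C).trans_le hgC

end BergmanOrlicz

/-- The canonical map, when each function of the Bergman-Orlicz space has finite modular. -/
noncomputable def canonicalMap {Ψ₁ Ψ₂ : OrliczFunction} {μ : Measure ℂ}
    (hμ : ∀ᵐ z ∂μ, z ∈ unitDisk)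
    (h : ∀ f : BergmanOrlicz Ψ₁, ∃ C : ℝ≥0,
      0 < C ∧ orliczModular Ψ₂ μ (BergmanOrlicz.rep f) C < ∞) :
    BergmanOrlicz Ψ₁ →ₗ[ℂ] OrliczSpace Ψ₂ μ where
  toFun f := ⟨AEEqFun.mk (BergmanOrlicz.rep f)
    (aestronglyMeasurable_of_differentiableOn hμ (BergmanOrlicz.differentiableOn_rep f)),
    by
      obtain ⟨C, hC, h⟩ := h f
      exact ⟨C, hC, by rwa [orliczModular_congr Ψ₂ (AEEqFun.coeFn_mk _ _)]⟩⟩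
  map_add' f g := by
    refine Subtype.ext ?_
    simp only [Submodule.coe_add, AEEqFun.mk_add_mk]
    exact AEEqFun.mk_eq_mk.2 (hμ.mono (BergmanOrlicz.eqOn_rep_add f g))
  map_smul' c f := by
    refine Subtype.ext ?_
    simp only [Submodule.coe_smul, RingHom.id_apply]
    exact AEEqFun.mk_eq_mk.2 (hμ.mono (BergmanOrlicz.eqOn_rep_smul c f))

theorem canonicalMap_coeFn {Ψ₁ Ψ₂ : OrliczFunction} {μ : Measure ℂ}
    (hμ : ∀ᵐ z ∂μ, z ∈ unitDisk)
    (h : ∀ f : BergmanOrlicz Ψ₁, ∃ C : ℝ≥0,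
      0 < C ∧ orliczModular Ψ₂ μ (BergmanOrlicz.rep f) C < ∞)
    (f : BergmanOrlicz Ψ₁) :
    ((canonicalMap hμ h f : ℂ →ₘ[μ] ℂ) : ℂ → ℂ) =ᵐ[μ] BergmanOrlicz.rep f :=
  AEEqFun.coeFn_mk _ _

theorem isCanonicalEmbedding_canonicalMap {Ψ₁ Ψ₂ : OrliczFunction} {μ : Measure ℂ}
    (hμ : ∀ᵐ z ∂μ, z ∈ unitDisk)
    (h : ∀ f : BergmanOrlicz Ψ₁, ∃ C : ℝ≥0,
      0 < C ∧ orliczModular Ψ₂ μ (BergmanOrlicz.rep f) C < ∞) :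
    IsCanonicalEmbedding (canonicalMap hμ h) := fun f _ hg hfg =>
  (canonicalMap_coeFn hμ h f).trans (hμ.mono (BergmanOrlicz.eqOn_rep f hg hfg))

/-! ### Sufficiency: compactness of the canonical map -/

theorem orliczModular_add_compl (Ψ : OrliczFunction) (μ : Measure ℂ) (g : ℂ → ℂ) (C : ℝ≥0)
    (r : ℝ) : orliczModular Ψ μ g C = orliczModular Ψ (μ.restrict {z | r < ‖z‖}) g C +
      orliczModular Ψ (μ.restrict {z | r < ‖z‖}ᶜ) g C :=
  (lintegral_add_compl _ (measurableSet_lt measurable_const measurable_norm)).symm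

/-- Away from the unit circle the modulars of a pointwise null and bounded sequence tend to zero. -/
theorem tendsto_orliczModular_restrict_compl {Ψ : OrliczFunction} {μ : Measure ℂ}
    [IsFiniteMeasure μ] (hμ : ∀ᵐ z ∂μ, z ∈ unitDisk) {d : ℕ → ℂ → ℂ} {r : ℝ} {B : ℝ≥0}
    (hd : ∀ n, DifferentiableOn ℂ (d n) unitDisk) (hB : ∀ n z, ‖z‖ ≤ r → ‖d n z‖₊ ≤ B)
    (h0 : ∀ z ∈ unitDisk, Tendsto (fun n => d n z) atTop (𝓝 0)) (C : ℝ≥0) :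
    Tendsto (fun n => orliczModular Ψ (μ.restrict {z | r < ‖z‖}ᶜ) (d n) C) atTop (𝓝 0) := by
  have hμ' : ∀ᵐ z ∂μ.restrict {z | r < ‖z‖}ᶜ, z ∈ unitDisk := ae_restrict_of_ae hμ
  have hS : MeasurableSet {z : ℂ | r < ‖z‖}ᶜ :=
    (measurableSet_lt measurable_const measurable_norm).compl
  rw [show (0 : ℝ≥0∞) = ∫⁻ _, 0 ∂μ.restrict {z | r < ‖z‖}ᶜ by simp]
  refine tendsto_lintegral_of_dominated_convergence' (fun _ => (Ψ (B / C) : ℝ≥0∞))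
    (fun n => orliczModular_aemeasurable Ψ (aestronglyMeasurable_of_differentiableOn hμ' (hd n)) C)
    (fun n => ?_) ?_ ?_
  · filter_upwards [ae_restrict_mem hS] with z hz
    have hz' : ‖z‖ ≤ r := not_lt.1 hz
    exact ENNReal.coe_le_coe.2 (Ψ.mono (by gcongr; exact hB n z hz'))
  · rw [lintegral_const]
    exact ENNReal.mul_ne_top ENNReal.coe_ne_top (measure_ne_top _ _)
  · filter_upwards [hμ'] with z hz
    have h1 : Tendsto (fun n => Ψ (‖d n z‖₊ / C)) atTop (𝓝 (Ψ (‖(0 : ℂ)‖₊ / C))) :=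
      (Ψ.continuous.tendsto _).comp ((h0 z hz).nnnorm.div_const C)
    simpa [Ψ.map_zero] using ENNReal.tendsto_coe.2 h1

/-- The limit condition on `K` makes the canonical map well defined and compact: a sequence in the
unit ball has a pointwise convergent subsequence, and the modulars of the differences are small near
the circle by the Carleson embedding and away from the circle by dominated convergence. -/
theorem compactCanonicalEmbedding_of_tendsto {μ : Measure ℂ} [IsFiniteMeasure μ]
    (hμ : μ unitDiskᶜ = 0) {Ψ₁ Ψ₂ : OrliczFunction}
    (hlim : Tendsto (fun h : ℝ => Ψ₁.inv (1 / ENNReal.ofReal (h ^ 2)) /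
        Ψ₂.inv (1 / (ENNReal.ofReal (h ^ 2) * carlesonK μ h))) (𝓝[>] 0) (𝓝 0)) :
    CompactCanonicalEmbedding Ψ₁ Ψ₂ μ := by
  have hμ' : ∀ᵐ z ∂μ, z ∈ unitDisk := hμ
  have hfin : ∀ f : BergmanOrlicz Ψ₁, ∃ C : ℝ≥0, 0 < C ∧
      orliczModular Ψ₂ μ (BergmanOrlicz.rep f) C < ∞ := by
    intro f
    obtain ⟨C, hC⟩ := exists_gt ‖f‖₊
    have hC0 : 0 < C := (zero_le (a := ‖f‖₊)).trans_lt hC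
    have hf := BergmanOrlicz.modular_rep_le_one (f := f) (C := C) hC
    have hd := BergmanOrlicz.differentiableOn_rep f
    obtain ⟨r, hr, h⟩ := exists_forall_orliczModular_restrict_le hμ hlim one_pos
    obtain ⟨B, hB⟩ := exists_norm_le_of_modular_le_one Ψ₁ hC0 hr
    refine ⟨C, hC0, ?_⟩
    rw [orliczModular_add_compl Ψ₂ μ _ C r]
    have h1 := h _ C hd hf
    rw [one_mul] at h1
    refine ENNReal.add_lt_top.2 ⟨h1.trans_lt ENNReal.one_lt_top, ?_⟩
    calc orliczModular Ψ₂ (μ.restrict {z | r < ‖z‖}ᶜ) (BergmanOrlicz.rep f) C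
        ≤ ∫⁻ _ in {z | r < ‖z‖}ᶜ, (Ψ₂ (B / C) : ℝ≥0∞) ∂μ := by
          refine setLIntegral_mono measurable_const fun z hz => ?_
          have hz' : ‖z‖ ≤ r := not_lt.1 hz
          exact ENNReal.coe_le_coe.2 (Ψ₂.mono (by gcongr; exact hB _ hd hf z hz'))
      _ < ∞ := by
          rw [lintegral_const]
          exact ENNReal.mul_lt_top ENNReal.coe_lt_top (measure_lt_top _ _)
  set T := canonicalMap hμ' hfin with hT
  refine ⟨T, isCanonicalEmbedding_canonicalMap hμ' hfin, T '' Metric.closedBall 0 1, ?_,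
    mem_of_superset (Metric.closedBall_mem_nhds _ one_pos) (subset_preimage_image _ _)⟩
  -- The image of the closed unit ball is sequentially compact.
  refine IsSeqCompact.isCompact fun y hy => ?_
  choose f hf hfy using hy
  have hfnorm : ∀ n, ‖f n‖ ≤ 1 := fun n => by simpa using hf n
  have hmod : ∀ C : ℝ≥0, 1 < C → ∀ n, orliczModular Ψ₁ diskArea (BergmanOrlicz.rep (f n)) C ≤ 1 :=
    fun C hC n => BergmanOrlicz.modular_rep_le_one ((hfnorm n).trans_lt (by exact_mod_cast hC))
  have hdiff := fun n => BergmanOrlicz.differentiableOn_rep (f n)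
  obtain ⟨g, φ, hg, hφ, hlimg⟩ := exists_strictMono_tendsto_of_locally_bounded hdiff
    (fun r hr => by
      obtain ⟨B, hB⟩ := exists_norm_le_of_modular_le_one Ψ₁ (two_pos (α := ℝ≥0)) hr
      exact ⟨B, fun n z hz => hB _ (hdiff n) (hmod 2 one_lt_two n) z hz⟩)
  have hgmod : ∀ C : ℝ≥0, 1 < C → orliczModular Ψ₁ diskArea g C ≤ 1 := fun C hC =>
    orliczModular_le_of_tendsto_ae (fun n => aestronglyMeasurable_diskArea (hdiff (φ n)))
      (Eventually.of_forall fun n => hmod C hC (φ n)) (ae_diskArea_mem_unitDisk.mono hlimg)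
  have hgfin : ∃ C : ℝ≥0, 0 < C ∧ orliczModular Ψ₁ diskArea g C < ∞ :=
    ⟨2, two_pos, (hgmod 2 one_lt_two).trans_lt ENNReal.one_lt_top⟩
  set F : BergmanOrlicz Ψ₁ := BergmanOrlicz.mk g hg hgfin with hF
  have hFnorm : ‖F‖ ≤ 1 := by
    refine le_of_forall_pos_le_add fun ε hε => ?_
    lift ε to ℝ≥0 using hε.le
    have hε' : 1 < 1 + ε := lt_add_of_pos_right _ (by exact_mod_cast hε)
    exact_mod_cast BergmanOrlicz.norm_mk_le hg hgfin (one_pos.trans hε') (hgmod _ hε')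
  have hFrep : EqOn (BergmanOrlicz.rep F) g unitDisk :=
    BergmanOrlicz.eqOn_rep F hg (BergmanOrlicz.coeFn_mk hg hgfin)
  refine ⟨T F, mem_image_of_mem _ (by simpa using hFnorm), φ, hφ, ?_⟩
  rw [tendsto_iff_norm_sub_tendsto_zero]
  set d : ℕ → BergmanOrlicz Ψ₁ := fun n => f (φ n) - F with hd
  have hTd : ∀ n, (y ∘ φ) n - T F = T (d n) := fun n => by
    rw [hd, map_sub, hfy, Function.comp_apply]
  simp only [hTd]
  have hdnorm : ∀ n, ‖d n‖ < (3 : ℝ≥0) := fun n => by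
    have := norm_sub_le (f (φ n)) F
    have := hfnorm (φ n)
    rw [hd]
    push_cast
    linarith
  have hdd := fun n => BergmanOrlicz.differentiableOn_rep (d n)
  have hdmod := fun n => BergmanOrlicz.modular_rep_le_one (hdnorm n)
  have hd0 : ∀ z ∈ unitDisk, Tendsto (fun n => BergmanOrlicz.rep (d n) z) atTop (𝓝 0) := by
    intro z hz
    have h1 : ∀ n, BergmanOrlicz.rep (d n) z = BergmanOrlicz.rep (f (φ n)) z - g z := fun n => by
      rw [hd, BergmanOrlicz.eqOn_rep_sub _ _ hz, Pi.sub_apply, hFrep hz]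
    simp only [h1]
    simpa using (hlimg z hz).sub_const (g z)
  refine Metric.tendsto_atTop'.2 fun ε hε => ?_
  lift ε to ℝ≥0 using hε.le
  have hε : 0 < ε := by exact_mod_cast hε
  -- Both parts of the modular with constant `ε / 4` are at most one, so by convexity the modular
  -- with constant `ε / 2` is at most one.
  obtain ⟨r, hr, h⟩ := exists_forall_orliczModular_restrict_le hμ hlim
    (show 0 < ε / 12 by positivity)
  obtain ⟨B, hB⟩ := exists_norm_le_of_modular_le_one Ψ₁ (three_pos (α := ℝ≥0)) hr
  have hin := tendsto_orliczModular_restrict_compl (Ψ := Ψ₂) hμ' hdd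
    (fun n z hz => hB _ (hdd n) (hdmod n) z hz) hd0 (ε / 12 * 3)
  obtain ⟨n₀, hn₀⟩ := eventually_atTop.1 (hin.eventually_le_const one_pos)
  refine ⟨n₀, fun n hn => ?_⟩
  have h2 : orliczModular Ψ₂ μ (BergmanOrlicz.rep (d n)) (ε / 12 * 3) ≤ 2 := by
    rw [orliczModular_add_compl Ψ₂ μ _ _ r]
    exact (add_le_add (h _ 3 (hdd n) (hdmod n)) (hn₀ n hn.le)).trans_eq one_add_one_eq_two
  have h3 : orliczModular Ψ₂ μ (BergmanOrlicz.rep (d n)) (2 * (ε / 12 * 3)) ≤ 1 := by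
    refine (orliczModular_mul_le Ψ₂ μ _ _ one_le_two).trans ((mul_le_mul_right h2 _).trans ?_)
    rw [ENNReal.coe_inv two_ne_zero]
    exact (ENNReal.inv_mul_cancel two_ne_zero (by simp)).le
  have h4 : ‖T (d n)‖ ≤ (2 * (ε / 12 * 3) : ℝ≥0) := by
    refine OrliczSpace.norm_le_of_modular_coe (by positivity) ?_
    rwa [orliczModular_congr Ψ₂ (canonicalMap_coeFn hμ' hfin (d n))]
  rw [dist_zero_right, norm_norm]
  refine h4.trans_lt ?_
  have : (0 : ℝ) < ε := by exact_mod_cast hε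
  push_cast
  linarith

/-! ### Test functions concentrated on Carleson windows -/

/-- The fourth power of `h / (1 - conj a z)` with `a = (1 - h) ξ`: a function of size one on the
Carleson window `W(ξ, h)` and of `L¹` norm at most a constant times `h²`. -/
noncomputable def carlesonTest (ξ : ℂ) (h : ℝ) (z : ℂ) : ℂ :=
  ((h : ℂ) / (1 - (1 - h : ℝ) * ((starRingEnd ℂ) ξ * z))) ^ 4

theorem norm_one_sub_mul_conj {ξ : ℂ} (hξ : ‖ξ‖ = 1) (h : ℝ) (z : ℂ) :
    ‖1 - ((1 - h : ℝ) : ℂ) * ((starRingEnd ℂ) ξ * z)‖ = ‖ξ - (1 - h : ℝ) * z‖ := by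
  have h1 : ξ * (starRingEnd ℂ) ξ = 1 := by
    rw [Complex.mul_conj, Complex.normSq_eq_norm_sq, hξ]; simp
  calc ‖1 - ((1 - h : ℝ) : ℂ) * ((starRingEnd ℂ) ξ * z)‖
      = ‖ξ * (1 - ((1 - h : ℝ) : ℂ) * ((starRingEnd ℂ) ξ * z))‖ := by rw [norm_mul, hξ, one_mul]
    _ = _ := by
      congr 1
      linear_combination (-((1 - h : ℝ) : ℂ) * z) * h1

section Estimates

variable {ξ : ℂ} {h : ℝ}

theorem norm_carlesonTest (hξ : ‖ξ‖ = 1) (hh : 0 < h) (z : ℂ) :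
    ‖carlesonTest ξ h z‖ = (h / ‖ξ - (1 - h : ℝ) * z‖) ^ 4 := by
  rw [carlesonTest, norm_pow, norm_div, norm_one_sub_mul_conj hξ, Complex.norm_real,
    Real.norm_of_nonneg hh.le]

theorem one_sub_mul_norm_le (hξ : ‖ξ‖ = 1) (h1 : h ≤ 1) (z : ℂ) :
    1 - (1 - h) * ‖z‖ ≤ ‖ξ - (1 - h : ℝ) * z‖ := by
  have := norm_sub_norm_le ξ ((1 - h : ℝ) * z)
  rwa [hξ, norm_mul, Complex.norm_real, Real.norm_of_nonneg (by linarith)] at this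

theorem norm_pos_of_mem_unitDisk (hξ : ‖ξ‖ = 1) (hh : 0 < h) (h1 : h ≤ 1) {z : ℂ}
    (hz : z ∈ unitDisk) : h ≤ ‖ξ - (1 - h : ℝ) * z‖ ∧ 1 - ‖z‖ ≤ ‖ξ - (1 - h : ℝ) * z‖ := by
  have hz := mem_unitDisk.1 hz
  have := one_sub_mul_norm_le hξ h1 z
  have := norm_nonneg z
  constructor <;> nlinarith

theorem differentiableOn_carlesonTest (hξ : ‖ξ‖ = 1) (hh : 0 < h) (h1 : h ≤ 1) :
    DifferentiableOn ℂ (carlesonTest ξ h) unitDisk := by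
  refine DifferentiableOn.pow (DifferentiableOn.div (by fun_prop) (by fun_prop) fun z hz => ?_) 4
  rw [← norm_ne_zero_iff, norm_one_sub_mul_conj hξ]
  exact (hh.trans_le (norm_pos_of_mem_unitDisk hξ hh h1 hz).1).ne'

theorem norm_carlesonTest_le_one (hξ : ‖ξ‖ = 1) (hh : 0 < h) (h1 : h ≤ 1) {z : ℂ}
    (hz : z ∈ unitDisk) : ‖carlesonTest ξ h z‖ ≤ 1 := by
  rw [norm_carlesonTest hξ hh]
  have := (norm_pos_of_mem_unitDisk hξ hh h1 hz).1
  refine pow_le_one₀ (by positivity) ?_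
  exact div_le_one_of_le₀ this (norm_nonneg _)

theorem norm_carlesonTest_le (hξ : ‖ξ‖ = 1) (hh : 0 < h) (h1 : h ≤ 1) {z : ℂ}
    (hz : z ∈ unitDisk) : ‖carlesonTest ξ h z‖ ≤ h ^ 4 / (1 - ‖z‖) ^ 4 := by
  rw [norm_carlesonTest hξ hh, div_pow]
  have := (norm_pos_of_mem_unitDisk hξ hh h1 hz).2
  have : 0 < 1 - ‖z‖ := by have := mem_unitDisk.1 hz; linarith
  gcongr

theorem norm_carlesonTest_le_rpow (hξ : ‖ξ‖ = 1) (hh : 0 < h) (h1 : h ≤ 1) {z : ℂ}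
    (hz : z ∈ unitDisk) :
    ‖carlesonTest ξ h z‖ ≤ 81 * (1 + ‖h⁻¹ • (z - ξ)‖) ^ (-4 : ℝ) := by
  obtain ⟨h2, -⟩ := norm_pos_of_mem_unitDisk hξ hh h1 hz
  have h3 : ‖z - ξ‖ ≤ 2 * ‖ξ - (1 - h : ℝ) * z‖ := by
    have h4 : ‖z - ξ‖ ≤ ‖ξ - (1 - h : ℝ) * z‖ + ‖(h : ℂ) * z‖ := by
      rw [norm_sub_rev]
      refine le_trans (le_of_eq ?_) (norm_sub_le _ _)
      congr 1
      push_cast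
      ring
    rw [norm_mul, Complex.norm_real, Real.norm_of_nonneg hh.le] at h4
    have := mem_unitDisk.1 hz
    nlinarith
  have hpos := hh.trans_le h2
  rw [norm_carlesonTest hξ hh, norm_smul, norm_inv, Real.norm_of_nonneg hh.le,
    Real.rpow_neg (by positivity)]
  have h5 : (1 + h⁻¹ * ‖z - ξ‖) ^ (4 : ℝ) = (1 + h⁻¹ * ‖z - ξ‖) ^ 4 := by norm_cast
  rw [h5]
  have h6 : h / ‖ξ - (1 - h : ℝ) * z‖ ≤ 3 * (1 + h⁻¹ * ‖z - ξ‖)⁻¹ := by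
    rw [← div_eq_mul_inv, div_le_div_iff₀ hpos (by positivity)]
    calc h * (1 + h⁻¹ * ‖z - ξ‖) = h + ‖z - ξ‖ := by field_simp
      _ ≤ _ := by linarith
  calc (h / ‖ξ - (1 - h : ℝ) * z‖) ^ 4 ≤ (3 * (1 + h⁻¹ * ‖z - ξ‖)⁻¹) ^ 4 := by gcongr
    _ = _ := by rw [mul_pow, inv_pow]; norm_num

/-- On the window, `|ξ - (1 - h) z| ≤ 6 h`. -/
theorem le_norm_carlesonTest (hξ : ‖ξ‖ = 1) (hh : 0 < h) (h1 : h ≤ 1) {z : ℂ}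
    (hz : z ∈ carlesonWindow ξ h) : 1 / 1296 ≤ ‖carlesonTest ξ h z‖ := by
  obtain ⟨hz, hzh, harg⟩ := hz
  set v := z * (starRingEnd ℂ) ξ with hv
  have hvz : ‖v‖ = ‖z‖ := by rw [hv, norm_mul, RCLike.norm_conj, hξ, mul_one]
  have hv1 : ‖1 - v‖ ≤ (Real.pi + 1) * h := by
    have hsplit : 1 - v = -(Complex.exp (Complex.I * v.arg) - 1) +
        ((1 - ‖v‖ : ℝ) : ℂ) * Complex.exp (Complex.I * v.arg) := by
      conv_lhs => rw [← Complex.norm_mul_exp_arg_mul_I v, mul_comm _ Complex.I]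
      push_cast
      ring
    have h2 : ‖Complex.exp (Complex.I * v.arg) - 1‖ ≤ |v.arg| := by
      simpa using Real.norm_exp_I_mul_ofReal_sub_one_le (x := v.arg)
    have h3 : ‖Complex.exp (Complex.I * v.arg)‖ = 1 := Complex.norm_exp_I_mul_ofReal _
    calc ‖1 - v‖ ≤ ‖Complex.exp (Complex.I * v.arg) - 1‖ + |1 - ‖v‖| := by
          rw [hsplit]
          refine (norm_add_le _ _).trans ?_
          rw [norm_neg, norm_mul, h3, mul_one, Complex.norm_real, Real.norm_eq_abs]
      _ ≤ Real.pi * h + h := by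
          refine add_le_add (h2.trans harg) ?_
          have := mem_unitDisk.1 hz
          rw [abs_of_nonneg (by linarith)]
          linarith
      _ = _ := by ring
  have hnorm : ‖ξ - (1 - h : ℝ) * z‖ ≤ 6 * h := by
    rw [← norm_one_sub_mul_conj hξ]
    have h4 : (1 : ℂ) - ((1 - h : ℝ) : ℂ) * ((starRingEnd ℂ) ξ * z) = (1 - v) + (h : ℂ) * v := by
      rw [hv]; push_cast; ring
    rw [h4]
    refine (norm_add_le _ _).trans ?_
    rw [norm_mul, Complex.norm_real, Real.norm_of_nonneg hh.le, hvz]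
    have := mem_unitDisk.1 hz
    nlinarith [Real.pi_le_four]
  have hpos := hh.trans_le (norm_pos_of_mem_unitDisk hξ hh h1 hz).1
  rw [norm_carlesonTest hξ hh]
  have h6 : 1 / 6 ≤ h / ‖ξ - (1 - h : ℝ) * z‖ := by
    rw [div_le_div_iff₀ (by norm_num) hpos]
    linarith
  calc (1 / 1296 : ℝ) = (1 / 6) ^ 4 := by norm_num
    _ ≤ _ := by gcongr

end Estimates

theorem lintegral_comp_inv_smul_sub (F : ℂ → ℝ≥0∞) (hF : Measurable F) {h : ℝ} (hh : 0 < h)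
    (ξ : ℂ) : ∫⁻ z, F (h⁻¹ • (z - ξ)) = ENNReal.ofReal (h ^ 2) * ∫⁻ z, F z := by
  rw [lintegral_sub_right_eq_self (fun z => F (h⁻¹ • z)) ξ,
    ← lintegral_map (f := F) (g := fun z : ℂ => h⁻¹ • z) hF (measurable_const_smul _),
    Measure.map_addHaar_smul _ (inv_pos.2 hh).ne', lintegral_smul_measure,
    Complex.finrank_real_complex, inv_pow, inv_inv, abs_of_pos (by positivity), smul_eq_mul]

/-- The `L¹` norm of the test functions is `O(h²)`, by comparison with a dilate of `(1 + |x|)⁻⁴`,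
which is integrable on the plane. -/
theorem exists_lintegral_carlesonTest_le :
    ∃ D : ℝ≥0, 1 ≤ D ∧ ∀ (ξ : ℂ) (h : ℝ), ‖ξ‖ = 1 → 0 < h → h ≤ 1 →
      ∫⁻ z, ‖carlesonTest ξ h z‖₊ ∂diskArea ≤ D * ENNReal.ofReal (h ^ 2) := by
  set J : ℝ≥0∞ := ∫⁻ x : ℂ, ENNReal.ofReal ((1 + ‖x‖) ^ (-4 : ℝ)) with hJ
  have hJfin : J < ∞ := finite_integral_one_add_norm (by
    rw [Complex.finrank_real_complex]; norm_num)
  refine ⟨1 + 81 * J.toNNReal, le_self_add, fun ξ h hξ hh h1 => ?_⟩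
  have hpi : ENNReal.ofReal (1 / Real.pi) ≤ 1 := by
    rw [ENNReal.ofReal_le_one, div_le_one Real.pi_pos]
    linarith [Real.pi_gt_three]
  have hm : Measurable fun x : ℂ => ENNReal.ofReal ((1 + ‖x‖) ^ (-4 : ℝ)) := by fun_prop
  calc ∫⁻ z, ‖carlesonTest ξ h z‖₊ ∂diskArea
      ≤ 1 * ∫⁻ z in unitDisk, ‖carlesonTest ξ h z‖₊ := by
        rw [lintegral_diskArea]
        gcongr
    _ ≤ 1 * ∫⁻ z in unitDisk, 81 * ENNReal.ofReal ((1 + ‖h⁻¹ • (z - ξ)‖) ^ (-4 : ℝ)) := by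
        refine mul_le_mul_right (setLIntegral_mono' isOpen_unitDisk.measurableSet fun z hz => ?_) _
        rw [← ENNReal.ofReal_coe_nnreal, coe_nnnorm,
          show (81 : ℝ≥0∞) = ENNReal.ofReal 81 by norm_num, ← ENNReal.ofReal_mul (by norm_num)]
        exact ENNReal.ofReal_le_ofReal (norm_carlesonTest_le_rpow hξ hh h1 hz)
    _ ≤ ∫⁻ z, 81 * ENNReal.ofReal ((1 + ‖h⁻¹ • (z - ξ)‖) ^ (-4 : ℝ)) := by
        rw [one_mul]
        exact setLIntegral_le_lintegral _ _
    _ = 81 * (ENNReal.ofReal (h ^ 2) * J) := by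
        rw [lintegral_const_mul' _ _ (by norm_num), lintegral_comp_inv_smul_sub _ hm hh]
    _ = 81 * J * ENNReal.ofReal (h ^ 2) := by ring
    _ ≤ _ := by
        gcongr
        push_cast
        rw [ENNReal.coe_toNNReal hJfin.ne]
        exact le_add_self

/-- Convexity of `Ψ` and the `L¹` bound put the multiples by `t` with `Ψ t ≤ 1 / h²` in one ball of
the Bergman-Orlicz space. -/
theorem orliczModular_carlesonTest_le {Ψ : OrliczFunction} {D : ℝ≥0} {ξ : ℂ} {h : ℝ}
    (hξ : ‖ξ‖ = 1) (hh : 0 < h) (h1 : h ≤ 1) (hD1 : 1 ≤ D)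
    (hint : ∫⁻ z, ‖carlesonTest ξ h z‖₊ ∂diskArea ≤ D * ENNReal.ofReal (h ^ 2))
    {t : ℝ≥0} (ht : (Ψ t : ℝ≥0∞) ≤ 1 / ENNReal.ofReal (h ^ 2)) :
    orliczModular Ψ diskArea (fun z => (t : ℝ) * carlesonTest ξ h z) D ≤ 1 := by
  have hD : 0 < D := one_pos.trans_le hD1
  have hD' : (D : ℝ≥0∞) ≠ 0 := by simpa using hD.ne'
  have hh2 : ENNReal.ofReal (h ^ 2) ≠ 0 := (ENNReal.ofReal_pos.2 (by positivity)).ne'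
  calc orliczModular Ψ diskArea (fun z => (t : ℝ) * carlesonTest ξ h z) D
      ≤ ∫⁻ z, ((D : ℝ≥0∞)⁻¹ * Ψ t) * ‖carlesonTest ξ h z‖₊ ∂diskArea := by
        refine lintegral_mono_ae (ae_diskArea_mem_unitDisk.mono fun z hz => ?_)
        have hle : ‖carlesonTest ξ h z‖₊ ≤ 1 := norm_carlesonTest_le_one hξ hh h1 hz
        have h2 : ‖((t : ℝ) : ℂ) * carlesonTest ξ h z‖₊ / D = (‖carlesonTest ξ h z‖₊ / D) * t := by
          rw [nnnorm_mul, Complex.nnnorm_real, NNReal.nnnorm_eq]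
          ring
        rw [h2]
        have h3 := Ψ.apply_mul_le (div_le_one_of_le₀ (hle.trans hD1) (zero_le (a := D))) t
        rw [← ENNReal.coe_inv hD.ne', ← ENNReal.coe_mul, ← ENNReal.coe_mul]
        refine ENNReal.coe_le_coe.2 (h3.trans (le_of_eq ?_))
        ring
    _ = ((D : ℝ≥0∞)⁻¹ * Ψ t) * ∫⁻ z, ‖carlesonTest ξ h z‖₊ ∂diskArea :=
        lintegral_const_mul' _ _ (ENNReal.mul_ne_top (ENNReal.inv_ne_top.2 hD') ENNReal.coe_ne_top)
    _ ≤ ((D : ℝ≥0∞)⁻¹ * (1 / ENNReal.ofReal (h ^ 2))) * (D * ENNReal.ofReal (h ^ 2)) := by gcongr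
    _ = ((D : ℝ≥0∞)⁻¹ * D) * ((ENNReal.ofReal (h ^ 2))⁻¹ * ENNReal.ofReal (h ^ 2)) := by
        rw [one_div]; ring
    _ = 1 := by
        rw [ENNReal.inv_mul_cancel hD' ENNReal.coe_ne_top,
          ENNReal.inv_mul_cancel hh2 ENNReal.ofReal_ne_top, one_mul]

/-- The multiples of the test functions in the unit ball are small at each fixed point, because
`Ψ` grows at least linearly. -/
theorem norm_mul_carlesonTest_le {Ψ : OrliczFunction} {ξ : ℂ} {h : ℝ} (hξ : ‖ξ‖ = 1) (hh : 0 < h)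
    (h1 : h ≤ 1) {t : ℝ≥0} (ht : (Ψ t : ℝ≥0∞) ≤ 1 / ENNReal.ofReal (h ^ 2)) {z : ℂ}
    (hz : z ∈ unitDisk) :
    ‖((t : ℝ) : ℂ) * carlesonTest ξ h z‖ ≤ (1 + 1 / (Ψ 1 : ℝ)) / (1 - ‖z‖) ^ 4 * h ^ 2 := by
  have hΨ : (0 : ℝ) < Ψ 1 := by exact_mod_cast Ψ.pos 1 one_pos
  have hz1 : 0 < 1 - ‖z‖ := by have := mem_unitDisk.1 hz; linarith
  have ht' : (Ψ t : ℝ) ≤ 1 / h ^ 2 := by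
    rw [one_div, ← ENNReal.ofReal_inv_of_pos (by positivity), ← ENNReal.ofReal_coe_nnreal,
      ENNReal.ofReal_le_ofReal_iff (by positivity)] at ht
    rwa [one_div]
  have hth : (t : ℝ) * h ^ 2 ≤ 1 + 1 / Ψ 1 := by
    rcases le_total t 1 with htt | htt
    · have h2 : (t : ℝ) ≤ 1 := by exact_mod_cast htt
      have h3 : h ^ 2 ≤ 1 := pow_le_one₀ hh.le h1
      have : 0 < 1 / (Ψ 1 : ℝ) := by positivity
      nlinarith [NNReal.coe_nonneg t, sq_nonneg h]
    · have h2 : (t : ℝ) * Ψ 1 ≤ Ψ t := by exact_mod_cast Ψ.mul_apply_one_le htt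
      have h3 : (t : ℝ) * h ^ 2 ≤ 1 / Ψ 1 := by
        rw [le_div_iff₀ hΨ]
        have h4 := h2.trans ht'
        rw [le_div_iff₀ (by positivity)] at h4
        linarith
      linarith
  rw [norm_mul, Complex.norm_real, NNReal.norm_eq]
  calc (t : ℝ) * ‖carlesonTest ξ h z‖ ≤ t * (h ^ 4 / (1 - ‖z‖) ^ 4) := by
        gcongr
        exact norm_carlesonTest_le hξ hh h1 hz
    _ = (t * h ^ 2) * (h ^ 2 / (1 - ‖z‖) ^ 4) := by ring
    _ ≤ (1 + 1 / (Ψ 1 : ℝ)) * (h ^ 2 / (1 - ‖z‖) ^ 4) := by gcongr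
    _ = _ := by ring

/-! ### Necessity: the limit condition -/

/-- A compact canonical map sends bounded pointwise null sequences to sequences with a norm null
subsequence: a norm limit point must be zero by Fatou's lemma. -/
theorem IsCompactOperator.exists_subseq_tendsto_zero {Ψ₁ Ψ₂ : OrliczFunction} {μ : Measure ℂ}
    (hμ : ∀ᵐ z ∂μ, z ∈ unitDisk) {T : BergmanOrlicz Ψ₁ →ₗ[ℂ] OrliczSpace Ψ₂ μ}
    (hT : IsCanonicalEmbedding T) (hTc : IsCompactOperator T) {f : ℕ → BergmanOrlicz Ψ₁} {D : ℝ}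
    (hf : ∀ n, ‖f n‖ ≤ D)
    (h0 : ∀ z ∈ unitDisk, Tendsto (fun n => BergmanOrlicz.rep (f n) z) atTop (𝓝 0)) :
    ∃ φ : ℕ → ℕ, StrictMono φ ∧ Tendsto (fun n => T (f (φ n))) atTop (𝓝 0) := by
  obtain ⟨K, hK, hTK⟩ := hTc.image_subset_compact_of_bounded
    (Metric.isBounded_closedBall (x := (0 : BergmanOrlicz Ψ₁)) (r := D))
  obtain ⟨k, -, φ, hφ, hlim⟩ := hK.tendsto_subseq (x := fun n => T (f n))
    (fun n => hTK (mem_image_of_mem _ (by simpa using hf n)))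
  refine ⟨φ, hφ, ?_⟩
  have hk : k = 0 := by
    refine OrliczSpace.eq_zero_of_tendsto_of_tendsto_ae hlim ?_
    have hae : ∀ᵐ z ∂μ, ∀ n, (T (f n) : ℂ →ₘ[μ] ℂ) z = BergmanOrlicz.rep (f n) z :=
      ae_all_iff.2 fun n => hT (f n) _ (BergmanOrlicz.differentiableOn_rep _)
        (BergmanOrlicz.coeFn_ae_eq_rep _)
    filter_upwards [hμ, hae] with z hz h1
    simp only [Function.comp_apply, h1]
    exact (h0 z hz).comp hφ.tendsto_atTop
  rwa [hk] at hlim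

/-- Under a compact canonical map the test functions tend to zero, uniformly in `ξ`. -/
theorem eventually_orliczModular_carlesonTest_le {Ψ₁ Ψ₂ : OrliczFunction} {μ : Measure ℂ}
    (hμ : ∀ᵐ z ∂μ, z ∈ unitDisk) (hcomp : CompactCanonicalEmbedding Ψ₁ Ψ₂ μ) {η : ℝ≥0}
    (hη : 0 < η) :
    ∀ᶠ h : ℝ in 𝓝[>] 0, ∀ ξ : ℂ, ‖ξ‖ = 1 → ∀ t : ℝ≥0,
      (Ψ₁ t : ℝ≥0∞) ≤ 1 / ENNReal.ofReal (h ^ 2) →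
      orliczModular Ψ₂ μ (fun z => (t : ℝ) * carlesonTest ξ h z) η ≤ 1 := by
  obtain ⟨T, hT, hTc⟩ := hcomp
  obtain ⟨D, hD1, hint⟩ := exists_lintegral_carlesonTest_le
  -- Otherwise some test functions with `h → 0` have images bounded away from zero, although they
  -- form a bounded pointwise null sequence.
  by_contra hcon
  have hfreq := (not_eventually.1 hcon).and_eventually
    (Ioo_mem_nhdsGT (show (0 : ℝ) < 1 by norm_num))
  obtain ⟨h, hh, hP⟩ := exists_seq_forall_of_frequently hfreq
  have hP1 := fun n => (hP n).1
  have hpos := fun n => (hP n).2.1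
  have hle := fun n => (hP n).2.2.le
  push Not at hP1
  choose ξ hξ t ht hlarge using hP1
  have hDpos : 0 < D := one_pos.trans_le hD1
  set G : ℕ → ℂ → ℂ := fun n z => (t n : ℝ) * carlesonTest (ξ n) (h n) z with hG
  have hGd : ∀ n, DifferentiableOn ℂ (G n) unitDisk := fun n =>
    (differentiableOn_carlesonTest (hξ n) (hpos n) (hle n)).const_mul _
  have hGm : ∀ n, orliczModular Ψ₁ diskArea (G n) D ≤ 1 := fun n =>
    orliczModular_carlesonTest_le (hξ n) (hpos n) (hle n) hD1
      (hint _ _ (hξ n) (hpos n) (hle n)) (ht n)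
  have hGfin : ∀ n, ∃ C : ℝ≥0, 0 < C ∧ orliczModular Ψ₁ diskArea (G n) C < ∞ := fun n =>
    ⟨D, hDpos, (hGm n).trans_lt ENNReal.one_lt_top⟩
  have hh0 : Tendsto h atTop (𝓝 0) := hh.mono_right nhdsWithin_le_nhds
  have hG0 : ∀ z ∈ unitDisk, Tendsto (fun n => G n z) atTop (𝓝 0) := fun z hz => by
    refine squeeze_zero_norm
      (fun n => norm_mul_carlesonTest_le (hξ n) (hpos n) (hle n) (ht n) hz) ?_
    simpa using (hh0.pow 2).const_mul ((1 + 1 / (Ψ₁ 1 : ℝ)) / (1 - ‖z‖) ^ 4)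
  obtain ⟨φ, -, hlim⟩ := hTc.exists_subseq_tendsto_zero hμ hT
    (f := fun n => BergmanOrlicz.mk (G n) (hGd n) (hGfin n))
    (fun n => BergmanOrlicz.norm_mk_le (hGd n) (hGfin n) hDpos (hGm n))
    (fun z hz => (hG0 z hz).congr fun n =>
      (BergmanOrlicz.eqOn_rep _ (hGd n) (BergmanOrlicz.coeFn_mk _ _) hz).symm)
  obtain ⟨n, hn⟩ := (hlim.norm.eventually_lt_const (u := (η : ℝ)) (by simpa using hη)).exists
  refine (hlarge (φ n)).not_ge ?_
  rw [← orliczModular_congr Ψ₂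
    (hT _ (G (φ n)) (hGd (φ n)) (BergmanOrlicz.coeFn_mk (hGd (φ n)) (hGfin (φ n))))]
  exact OrliczSpace.modular_le_one_of_norm_lt_coe hn

/-- If the canonical map is compact, the test functions have small norm in `L^Ψ₂(μ)`, and Markov's
inequality on the windows turns this into the limit. -/
theorem tendsto_of_compactCanonicalEmbedding {μ : Measure ℂ} (hμ : μ unitDiskᶜ = 0)
    {Ψ₁ Ψ₂ : OrliczFunction} (hcomp : CompactCanonicalEmbedding Ψ₁ Ψ₂ μ) :
    Tendsto (fun h : ℝ => Ψ₁.inv (1 / ENNReal.ofReal (h ^ 2)) /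
        Ψ₂.inv (1 / carlesonFunction μ h)) (𝓝[>] 0) (𝓝 0) := by
  have hμ' : ∀ᵐ z ∂μ, z ∈ unitDisk := hμ
  refine ENNReal.tendsto_nhds_zero.2 fun ε₀ hε₀ => ?_
  obtain ⟨ε, hε, hεε₀⟩ := ENNReal.lt_iff_exists_nnreal_btwn.1 hε₀
  have hε : 0 < ε := by exact_mod_cast hε
  filter_upwards [eventually_orliczModular_carlesonTest_le hμ' hcomp
    (show 0 < ε / 1296 by positivity), Ioo_mem_nhdsGT (show (0 : ℝ) < 1 by norm_num)] with h hmod hh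
  refine le_trans (ENNReal.div_le_of_le_mul (sSup_le ?_)) hεε₀.le
  rintro _ ⟨t, rfl, ht⟩
  -- The factor `1296` is the inverse of the lower bound of the test functions on the windows.
  suffices hΨ : (Ψ₂ (t / ε) : ℝ≥0∞) ≤ 1 / carlesonFunction μ h by
    have h1 := Ψ₂.le_inv hΨ
    rw [ENNReal.coe_div hε.ne'] at h1
    rw [mul_comm]
    exact (ENNReal.div_le_iff (by simpa using hε.ne') ENNReal.coe_ne_top).1 h1
  rw [ENNReal.le_div_iff_mul_le (Or.inr one_ne_zero) (Or.inr ENNReal.one_ne_top), mul_comm,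
    carlesonFunction, ENNReal.iSup_mul]
  refine iSup_le fun ξ => ?_
  rw [ENNReal.iSup_mul]
  refine iSup_le fun hξ => ?_
  have hξ : ‖ξ‖ = 1 := by simpa using hξ
  have hd : DifferentiableOn ℂ (fun z => (t : ℝ) * carlesonTest ξ h z) unitDisk :=
    (differentiableOn_carlesonTest hξ hh.1 hh.2.le).const_mul _
  have hsub : carlesonWindow ξ h ⊆ {z | (Ψ₂ (t / ε) : ℝ≥0∞) ≤
      Ψ₂ (‖((t : ℝ) : ℂ) * carlesonTest ξ h z‖₊ / (ε / 1296))} := by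
    intro z hz
    have h1 := le_norm_carlesonTest hξ hh.1 hh.2.le hz
    refine ENNReal.coe_le_coe.2 (Ψ₂.mono ?_)
    have h2 : (1 / 1296 : ℝ≥0) ≤ ‖carlesonTest ξ h z‖₊ := by
      rw [← NNReal.coe_le_coe]; exact_mod_cast h1
    rw [nnnorm_mul, Complex.nnnorm_real, NNReal.nnnorm_eq]
    calc t / ε = t * (1 / 1296) / (ε / 1296) := by field_simp
      _ ≤ _ := by gcongr
  calc μ (carlesonWindow ξ h) * Ψ₂ (t / ε)
      ≤ Ψ₂ (t / ε) * μ {z | (Ψ₂ (t / ε) : ℝ≥0∞) ≤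
          Ψ₂ (‖((t : ℝ) : ℂ) * carlesonTest ξ h z‖₊ / (ε / 1296))} := by
        rw [mul_comm]
        gcongr
    _ ≤ orliczModular Ψ₂ μ (fun z => (t : ℝ) * carlesonTest ξ h z) (ε / 1296) :=
        mul_meas_ge_le_lintegral₀ (orliczModular_aemeasurable Ψ₂
          (aestronglyMeasurable_of_differentiableOn hμ' hd) _) _
    _ ≤ 1 := hmod ξ hξ t ht

theorem mainTheorem5 (μ : Measure ℂ) [IsFiniteMeasure μ] (hμ : μ unitDiskᶜ = 0)
    (Ψ₁ Ψ₂ : OrliczFunction) :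
    (CompactCanonicalEmbedding Ψ₁ Ψ₂ μ →
      Tendsto (fun h : ℝ => Ψ₁.inv (1 / ENNReal.ofReal (h ^ 2)) /
        Ψ₂.inv (1 / carlesonFunction μ h)) (𝓝[>] 0) (𝓝 0)) ∧
    (Tendsto (fun h : ℝ => Ψ₁.inv (1 / ENNReal.ofReal (h ^ 2)) /
        Ψ₂.inv (1 / (ENNReal.ofReal (h ^ 2) * carlesonK μ h))) (𝓝[>] 0) (𝓝 0) →
      CompactCanonicalEmbedding Ψ₁ Ψ₂ μ) := by
  exact ⟨tendsto_of_compactCanonicalEmbedding hμ, compactCanonicalEmbedding_of_tendsto hμ⟩
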